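/- **Setting.** Let $n\ge 3$, $p\ge 2$, let $(X_1,Y_1),\dots,(X_n,Y_n)$ be independent copies of $(X,Y)\in\mathbf R^p\times\mathcal Y$, and write $\mathbb E_n[f(X_i,Y_i)]=n^{-1}\sum_{i=1}^n f(X_i,Y_i)$. Let $m:\mathbf R\times\mathcal Y\to\mathbf R$ be a measurable loss, $m_1'$ its derivative in the first argument, $\Theta\subseteq\mathbf R^p$, and let $\theta_0\in\Theta$ minimize $M(\theta)=\mathrm E[m(X^\top\theta,Y)]$ over $\Theta$. Let $T=\{j:\theta_{0j}\ne0\}$ and $s=|T|\ge 1$. Let $c_0>1$, $\bar c_0=(c_0+1)/(c_0-1)$, $\alpha\in(0,1)$, and let $c_M,c_M',\zeta_n,C_X,c_L,C_L,d>0$ and $B_n\ge1$ be constants such that: 1. $\Theta$ is convex and $\theta_0$ is an interior point of $\Theta$. 2. $t\mapsto m(t,y)$ is convex for every $y\in\mathcal Y$. 3. For every $\theta\in\Theta$, $m_1'(X^\top\theta,Y)$ exists almost surely and $\mathrm E|m(X^\top\theta,Y)|<\infty$. 4. $M(\theta)-M(\theta_0)\ge c_M\|\theta-\theta_0\|_2^2$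 for all $\theta\in\Theta$ with $\|\theta-\theta_0\|_1\le c_M'$. 5. Each of the two events $\max_{i}\|X_i\|_\infty\le B_n$ and $\max_j\sum_{i=1}^nX_{ij}^4\le nC_X^4$ has probability at least $1-\zeta_n$. 6. (i) There is a function $L\ge0$ with $\mathrm E[L(X,Y)^8]\le(C_L/2)^8$ such that, for almost every value $(x,y)$ of $(X,Y)$, $|m(x^\top\theta_0+t_1,y)-m(x^\top\theta_0+t_2,y)|\le L(x,y)|t_1-t_2|$ whenever $|t_1|\vee|t_2|\le c_L$; (ii) $\mathrm E[\{m(X^\top\theta,Y)-m(X^\top\theta_0,Y)\}^2]\le C_L^2t^2$ for all $t\in[0,c_L]$ and $\theta\in\Theta$ with $\|\theta-\theta_0\|_2\le t$. 7. $\mathrm E[m_1'(X^\top\theta_0,Y)\mid X]=0$ almost surely. 8. There are measurable functions $\underline r,\overline r$ on $\mathbf R^p$ such that almost surely $m_1'(X^\top\theta_0,Y)\in[\underline r(X),\overline r(X)]$ and $\overline r(X)-\underline r(X)\le d$. Define the analytic penalty $$\widehat\lambda^{\mathtt{am}}_\alpha=c_0d\sqrt{\frac{\ln(2p/\alpha)}{2n}\max_{1\le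 j\le p}\mathbb E_n[X_{ij}^2]},$$ the constants $C_\epsilon=16\sqrt2(1+\bar c_0)C_LC_X$ and $C_\lambda=c_0C_Xd$, and $$u_0=\frac2{c_M}\Big(C_\epsilon\sqrt{\tfrac{s\ln(pn)}n}+(1+\bar c_0)C_\lambda\sqrt{\tfrac{s\ln(p/\alpha)}n}\Big).$$ Suppose that $$s\ln(pn)\ge\frac{16C_L^2}{C_\epsilon^2}\quad\text{and}\quad(1+\bar c_0)u_0\sqrt s\le\frac{c_L}{B_n}\wedge c_M',$$ and, to exclude a degenerate case, that either $X\ne0$ almost surely (so that $\widehat\lambda^{\mathtt{am}}_\alpha>0$ almost surely), or there is $\delta\in\mathbf R^p$ with $\|\delta\|_2=u_0$, $\theta_0+\delta\in\Theta$ and $\sum_{j\notin T}|\delta_j|\le\bar c_0\sum_{j\in T}|\delta_j|$ (as is the case, for instance, when $\Theta=\mathbf R^p$). **Theorem.** With probability at least $1-\alpha-5n^{-1}-9\zeta_n$, every solution $$\widehat\theta\in\operatorname*{argmin}_{\theta\in\Theta}\big\{\mathbb E_n[m(X_i^\top\theta,Y_i)]+\widehat\lambda^{\mathtt{am}}_\alpha\|\theta\|_1\big\}$$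 satisfies both $$\|\widehat\theta-\theta_0\|_2\le\frac2{c_M}\Big(C_\epsilon\sqrt{\tfrac{s\ln(pn)}n}+(1+\bar c_0)C_\lambda\sqrt{\tfrac{s\ln(p/\alpha)}n}\Big)$$ and $$\|\widehat\theta-\theta_0\|_1\le\frac{2(1+\bar c_0)}{c_M}\Big(C_\epsilon\sqrt{\tfrac{s^2\ln(pn)}n}+(1+\bar c_0)C_\lambda\sqrt{\tfrac{s^2\ln(p/\alpha)}n}\Big).$$ -/

import Mathlib

open MeasureTheory ProbabilityTheory

noncomputable section

namespace PenalizedM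

/-- Vectors in `ℝ^p`; the norm `‖·‖` is the Euclidean one. -/
abbrev Vec (p : ℕ) : Type := EuclideanSpace ℝ (Fin p)

/-- The `ℓ¹` norm. -/
def l1Norm {p : ℕ} (δ : Vec p) : ℝ := ∑ j, |δ j|

/-- The set `T` of indices of the nonzero coordinates of `θ₀`. -/
def activeSet {p : ℕ} (θ₀ : Vec p) : Finset (Fin p) := Finset.univ.filter (fun j => θ₀ j ≠ 0)

/-- The number `s` of nonzero coordinates of `θ₀`. -/
def sparsity {p : ℕ} (θ₀ : Vec p) : ℕ := (activeSet θ₀).card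

/-- The restricted set: `δ` with `‖δ_{Tᶜ}‖₁ ≤ c ‖δ_T‖₁` and `θ₀ + δ ∈ Θ`. -/
def restrictedSet {p : ℕ} (Θ : Set (Vec p)) (θ₀ : Vec p) (c : ℝ) : Set (Vec p) :=
  {δ | ∑ j ∈ (activeSet θ₀)ᶜ, |δ j| ≤ c * ∑ j ∈ activeSet θ₀, |δ j| ∧ θ₀ + δ ∈ Θ}

section Model

variable {p n : ℕ} {𝒴 : Type*}

/-- The loss `m(xᵀθ, y)` of the parameter `θ` at the datum `w = (x, y)`. -/
def lossAt (m : ℝ → 𝒴 → ℝ) (θ : Vec p) (w : Vec p × 𝒴) : ℝ := m (inner ℝ w.1 θ) w.2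

/-- The residual `m₁'(xᵀθ₀, y)`, the derivative of the loss in its first argument. -/
def residual (m : ℝ → 𝒴 → ℝ) (θ₀ : Vec p) (w : Vec p × 𝒴) : ℝ :=
  deriv (fun t => m t w.2) (inner ℝ w.1 θ₀)

/-- The empirical risk `𝔼ₙ[m(Xᵢᵀθ, Yᵢ)]` of the data `w`. -/
def empiricalRisk (m : ℝ → 𝒴 → ℝ) (w : Fin n → Vec p × 𝒴) (θ : Vec p) : ℝ :=
  (1 / (n : ℝ)) * ∑ i, lossAt m θ (w i)

/-- All solutions of the `ℓ¹`-penalized M-estimation problem with data `w` and penalty `lam`. -/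
def penalizedSolutions (m : ℝ → 𝒴 → ℝ) (Θ : Set (Vec p)) (w : Fin n → Vec p × 𝒴) (lam : ℝ) :
    Set (Vec p) :=
  {θ | θ ∈ Θ ∧ IsMinOn (fun θ' => empiricalRisk m w θ' + lam * l1Norm θ') Θ θ}

/-- The analytic penalty level
`c₀ d √(ln(2p/α)/(2n) · max_j 𝔼ₙ[X_{ij}²])`. -/
def analyticPenalty (c₀ d α : ℝ) (w : Fin n → Vec p × 𝒴) : ℝ :=
  c₀ * d * Real.sqrt (Real.log (2 * (p : ℝ) / α) / (2 * (n : ℝ)) *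
    ⨆ j : Fin p, (1 / (n : ℝ)) * ∑ i, ((w i).1 j) ^ 2)

variable [MeasurableSpace 𝒴]

/-- The population risk `M(θ) = E[m(Xᵀθ, Y)]`. -/
def risk (m : ℝ → 𝒴 → ℝ) (P : Measure (Vec p × 𝒴)) (θ : Vec p) : ℝ := ∫ w, lossAt m θ w ∂P

/-- The excess risk `M(θ) - M(θ₀)`. -/
def excessRisk (m : ℝ → 𝒴 → ℝ) (P : Measure (Vec p × 𝒴)) (θ₀ θ : Vec p) : ℝ :=
  risk m P θ - risk m P θ₀

/-- Differentiability and integrability: for every `θ ∈ Θ`, the derivative `m₁'(Xᵀθ, Y)` exists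
almost surely and `m(Xᵀθ, Y)` is integrable. -/
def DiffAndIntegrable (m : ℝ → 𝒴 → ℝ) (P : Measure (Vec p × 𝒴)) (Θ : Set (Vec p)) : Prop :=
  ∀ θ ∈ Θ, (∀ᵐ w ∂P, DifferentiableAt ℝ (fun t => m t w.2) (inner ℝ w.1 θ)) ∧
    Integrable (lossAt m θ) P

/-- The margin condition with constants `cM` and `cM'`. -/
def Margin (m : ℝ → 𝒴 → ℝ) (P : Measure (Vec p × 𝒴)) (Θ : Set (Vec p)) (θ₀ : Vec p)
    (cM cM' : ℝ) : Prop :=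
  ∀ θ ∈ Θ, l1Norm (θ - θ₀) ≤ cM' → cM * ‖θ - θ₀‖ ^ 2 ≤ excessRisk m P θ₀ θ

/-- Covariate condition on the sample: each of the two bounds holds with probability at least
`1 - ζ`. -/
def CovariateBounds {Ω : Type*} [MeasurableSpace Ω] (μ : Measure Ω)
    (W : Fin n → Ω → Vec p × 𝒴) (ζ B CX : ℝ) : Prop :=
  1 - ζ ≤ μ.real {ω | ∀ i j, |(W i ω).1 j| ≤ B} ∧
  1 - ζ ≤ μ.real {ω | ∀ j, ∑ i, ((W i ω).1 j) ^ 4 ≤ (n : ℝ) * CX ^ 4}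

/-- Local loss behaviour with constants `cL` and `CL`: a local Lipschitz bound whose constant `L(W)`
has a bounded eighth moment, and mean-square continuity of the loss at `θ₀`. -/
def LocalLossBehavior (m : ℝ → 𝒴 → ℝ) (P : Measure (Vec p × 𝒴)) (Θ : Set (Vec p)) (θ₀ : Vec p)
    (cL CL : ℝ) : Prop :=
  (∃ L : Vec p × 𝒴 → ℝ, (∀ w, 0 ≤ L w) ∧
    (∀ᵐ w ∂P, ∀ t₁ t₂ : ℝ, |t₁| ≤ cL → |t₂| ≤ cL →
      |m (inner ℝ w.1 θ₀ + t₁) w.2 - m (inner ℝ w.1 θ₀ + t₂) w.2| ≤ L w * |t₁ - t₂|) ∧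
    Integrable (fun w => L w ^ 8) P ∧ ∫ w, L w ^ 8 ∂P ≤ (CL / 2) ^ 8) ∧
  (∀ t ∈ Set.Icc 0 cL, ∀ θ ∈ Θ, ‖θ - θ₀‖ ≤ t →
    Integrable (fun w => (lossAt m θ w - lossAt m θ₀ w) ^ 2) P ∧
    ∫ w, (lossAt m θ w - lossAt m θ₀ w) ^ 2 ∂P ≤ CL ^ 2 * t ^ 2)

/-- The residual is integrable and has conditional mean zero given the regressors. -/
def ResidualCondMeanZero (m : ℝ → 𝒴 → ℝ) (P : Measure (Vec p × 𝒴)) (θ₀ : Vec p) : Prop :=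
  Integrable (residual m θ₀) P ∧
  P[residual m θ₀ | MeasurableSpace.comap Prod.fst (inferInstance : MeasurableSpace (Vec p))]
    =ᵐ[P] 0

/-- Given the regressors, the residual lies in an interval of width at most `d`. -/
def ResidualInterval (m : ℝ → 𝒴 → ℝ) (P : Measure (Vec p × 𝒴)) (θ₀ : Vec p) (d : ℝ) : Prop :=
  ∃ rlo rhi : Vec p → ℝ, Measurable rlo ∧ Measurable rhi ∧
    ∀ᵐ w ∂P, residual m θ₀ w ∈ Set.Icc (rlo w.1) (rhi w.1) ∧ rhi w.1 - rlo w.1 ≤ d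

end Model

/-- `c̄₀ = (c₀ + 1)/(c₀ - 1)`. -/
def cBar (c₀ : ℝ) : ℝ := (c₀ + 1) / (c₀ - 1)

/-- `C_ε = 16 √2 (1 + c̄₀) C_L C_X`. -/
def CEps (c₀ CL CX : ℝ) : ℝ := 16 * Real.sqrt 2 * (1 + cBar c₀) * CL * CX

/-- `C_λ = c₀ C_X d`. -/
def CLam (c₀ CX d : ℝ) : ℝ := c₀ * CX * d

/-- `u₀ = (2/c_M) (C_ε √(s ln(pn)/n) + (1 + c̄₀) C_λ √(s ln(p/α)/n))`. -/
def uZero (n p s : ℕ) (c₀ cM CL CX d α : ℝ) : ℝ :=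
  2 / cM * (CEps c₀ CL CX * Real.sqrt (s * Real.log (p * n) / n) +
    (1 + cBar c₀) * CLam c₀ CX d * Real.sqrt (s * Real.log (p / α) / n))

end PenalizedM

end

/-!
The argument is deterministic on an event, and the event is controlled by three probabilistic
estimates.

*Deterministic part.* When the penalty dominates `c₀` times the sup norm of the score, the convexity
of the loss forces the error of every solution into the restricted set (`sub_mem_restrictedSet`).
If the error were longer than `u₀`, shrinking it to length `u₀` would give a direction `δ` in the
restricted set along which the empirical risk grows by at most the penalty times `√s u₀`, again by
convexity (`exists_mem_sphere_of_lt_norm`). By the margin condition the population risk grows by at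
least `c_M u₀²`, so the empirical process at `δ` would have to exceed `c_M u₀²` minus the penalty
term; `u₀` is chosen to make this impossible when the empirical process is at most `ε u₀` with
`ε = C_ε √(s ln(pn)/n)` (`norm_sub_le_of_sample`). A vanishing penalty means that all regressors in
the sample vanish, so that the empirical risk is constant; the nondegeneracy assumption then leads
to the same contradiction.

*Score.* Given the regressors, the score is a weighted sum of independent centred variables in
intervals of width `d`. Disintegrating the law of the regressor and the residual with a conditional
kernel (`pi_compProd`) and applying Hoeffding's inequality conditionally gives the probability `α`
(`measure_score_le`); the penalty level is at least `c₀` times the resulting bound.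

*Size of the penalty.* The bound on the fourth moments of the regressors in the sample controls
their second moments (`analyticPenalty_le`).

*Empirical process.* Symmetrization in probability (`symmetrization`) reduces the supremum over the
sphere to a Rademacher process with the sample fixed. The contraction principle for exponentials
of suprema (`rademacher_contraction`) replaces the loss differences by `L(Xᵢ, Yᵢ) Xᵢᵀδ`, and the
duality of `ℓ¹` and `ℓ^∞` leaves a maximum over `p` coordinates, which is sub-Gaussian with variance
proxy `∑ᵢ L(Xᵢ, Yᵢ)² Xᵢⱼ² ≤ n C_L² C_X²` outside an event controlled by Chebyshev's inequality and
the assumptions on the covariates. The constant `C_ε` makes the tail `4p (pn)⁻¹⁶`. Finite sets of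
directions suffice, because all directions can be approximated by countably many without changing
the value of the process (`measure_exists_deviation_gt_le`).
-/

noncomputable section

namespace PenalizedM

/-! ### Rademacher sums: comparison and exponential tail -/

/-- The value `±1` of a sign, with signs encoded as Booleans. -/
def signVal (b : Bool) : ℝ := cond b 1 (-1)

/-- Weak majorization of `(u, v)` by `(a, c)` suffices to compare sums of an increasing convex
function, here the exponential. -/
lemma exp_add_exp_le {u v a c : ℝ} (hmax : max u v ≤ max a c) (hadd : u + v ≤ a + c) :
    Real.exp u + Real.exp v ≤ Real.exp a + Real.exp c := by
  wlog huv : v ≤ u generalizing u v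
  · rw [add_comm]
    exact this (by rwa [max_comm]) (by linarith) (le_of_not_ge huv)
  wlog hac : c ≤ a generalizing a c
  · rw [add_comm (Real.exp a)]
    exact this (by rwa [max_comm c]) (by linarith) (le_of_not_ge hac)
  rw [max_eq_left huv, max_eq_left hac] at hmax
  have h1 : Real.exp u * (a - u) ≤ Real.exp a - Real.exp u := by
    have := Real.add_one_le_exp (a - u)
    have h := mul_le_mul_of_nonneg_left this (Real.exp_pos u).le
    rw [← Real.exp_add, add_sub_cancel] at h
    linarith
  have h2 : Real.exp v - Real.exp c ≤ Real.exp v * (v - c) := by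
    have := Real.add_one_le_exp (c - v)
    have h := mul_le_mul_of_nonneg_left this (Real.exp_pos v).le
    rw [← Real.exp_add, add_sub_cancel] at h
    linarith
  have h3 : Real.exp v * (v - c) ≤ Real.exp v * (a - u) :=
    mul_le_mul_of_nonneg_left (by linarith) (Real.exp_pos v).le
  have h4 : Real.exp v * (a - u) ≤ Real.exp u * (a - u) :=
    mul_le_mul_of_nonneg_right (Real.exp_le_exp.2 huv) (by linarith)
  linarith

section Contraction

variable {ι : Type*} {T : Finset ι}

/-- The contraction principle for a single sign. -/
lemma exp_sup_add_exp_sup_le (hT : T.Nonempty) (h a b : ι → ℝ)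
    (hlip : ∀ s ∈ T, ∀ t ∈ T, |b s - b t| ≤ |a s - a t|) (hzero : ∀ t ∈ T, |b t| ≤ |a t|) :
    Real.exp (T.sup' hT fun t => h t + b t) + Real.exp (T.sup' hT fun t => h t - b t) ≤
      Real.exp (T.sup' hT fun t => h t + a t) + Real.exp (T.sup' hT fun t => h t - a t) := by
  obtain ⟨t, ht, hut⟩ := T.exists_mem_eq_sup' hT fun t => h t + b t
  obtain ⟨s, hs, hvs⟩ := T.exists_mem_eq_sup' hT fun t => h t - b t
  have hA : ∀ r ∈ T, h r + a r ≤ T.sup' hT fun t => h t + a t :=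
    fun r hr => Finset.le_sup' (fun t => h t + a t) hr
  have hC : ∀ r ∈ T, h r - a r ≤ T.sup' hT fun t => h t - a t :=
    fun r hr => Finset.le_sup' (fun t => h t - a t) hr
  rw [hut, hvs]
  refine exp_add_exp_le (max_le ?_ ?_) ?_
  · have hb := (le_abs_self (b t)).trans (hzero t ht)
    rcases abs_cases (a t) with ha | ha
    · exact le_max_of_le_left (by linarith [hA t ht])
    · exact le_max_of_le_right (by linarith [hC t ht])
  · have hb := (neg_le_abs (b s)).trans (hzero s hs)
    rcases abs_cases (a s) with ha | ha
    · exact le_max_of_le_left (by linarith [hA s hs])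
    · exact le_max_of_le_right (by linarith [hC s hs])
  · have hb := (le_abs_self (b t - b s)).trans (hlip t ht s hs)
    rcases abs_cases (a t - a s) with ha | ha
    · linarith [hA t ht, hC s hs]
    · linarith [hA s hs, hC t ht]

lemma sum_signs_succ {n : ℕ} (g : (Fin (n + 1) → Bool) → ℝ) :
    ∑ ε, g ε = ∑ ε : Fin n → Bool, (g (Fin.cons true ε) + g (Fin.cons false ε)) := by
  rw [← (Fin.consEquiv fun _ : Fin (n + 1) => Bool).sum_comp, Fintype.sum_prod_type,
    Fintype.sum_bool, Finset.sum_add_distrib]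
  rfl

/-- The Ledoux–Talagrand contraction principle for exponentials of suprema of Rademacher sums.
The shift `h` makes the induction on the number of signs possible. -/
lemma rademacher_contraction (hT : T.Nonempty) {n : ℕ} (h : ι → ℝ) (a b : Fin n → ι → ℝ)
    (hlip : ∀ i, ∀ s ∈ T, ∀ t ∈ T, |b i s - b i t| ≤ |a i s - a i t|)
    (hzero : ∀ i, ∀ t ∈ T, |b i t| ≤ |a i t|) :
    ∑ ε : Fin n → Bool, Real.exp (T.sup' hT fun t => h t + ∑ i, signVal (ε i) * b i t) ≤
      ∑ ε : Fin n → Bool, Real.exp (T.sup' hT fun t => h t + ∑ i, signVal (ε i) * a i t) := by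
  induction n generalizing h with
  | zero => simp
  | succ n ih =>
    rw [sum_signs_succ, sum_signs_succ, Finset.sum_add_distrib]
    simp only [Fin.sum_univ_succ, Fin.cons_zero, Fin.cons_succ, signVal, cond_true, cond_false,
      one_mul, neg_mul]
    have ih1 := ih (fun t => h t + b 0 t) (fun i => a i.succ) (fun i => b i.succ)
      (fun i => hlip i.succ) (fun i => hzero i.succ)
    have ih2 := ih (fun t => h t - b 0 t) (fun i => a i.succ) (fun i => b i.succ)
      (fun i => hlip i.succ) (fun i => hzero i.succ)
    simp only [signVal, sub_eq_add_neg, add_assoc] at ih1 ih2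
    refine (add_le_add ih1 ih2).trans ?_
    rw [← Finset.sum_add_distrib]
    refine Finset.sum_le_sum fun ε _ => ?_
    have key := exp_sup_add_exp_sup_le hT
      (fun t => h t + ∑ i : Fin n, signVal (ε i) * a i.succ t) (a 0) (b 0) (hlip 0) (hzero 0)
    refine le_of_eq_of_le ?_ (key.trans_eq ?_) <;> congr 3 <;> funext t <;> simp only [signVal] <;>
      ring

end Contraction

lemma sum_signs_exp {n : ℕ} (c : Fin n → ℝ) :
    ∑ ε : Fin n → Bool, Real.exp (∑ i, signVal (ε i) * c i) = ∏ i, (2 * Real.cosh (c i)) := by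
  have h : ∀ i, 2 * Real.cosh (c i) = ∑ b : Bool, Real.exp (signVal b * c i) := by
    intro i
    rw [Real.cosh_eq, Fintype.sum_bool]
    simp only [signVal, cond_true, cond_false, one_mul, neg_mul]
    ring
  simp_rw [h, Finset.prod_univ_sum, Fintype.piFinset_univ, Real.exp_sum]

lemma sum_signs_exp_le {n : ℕ} (c : Fin n → ℝ) :
    ∑ ε : Fin n → Bool, Real.exp (∑ i, signVal (ε i) * c i) ≤
      2 ^ n * Real.exp ((∑ i, c i ^ 2) / 2) := by
  rw [sum_signs_exp, Finset.prod_mul_distrib, Finset.sum_div, Real.exp_sum]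
  simp only [Finset.prod_const, Finset.card_univ, Fintype.card_fin]
  gcongr with i
  exact Real.cosh_le_exp_half_sq (c i)

lemma l1Norm_nonneg {p : ℕ} (δ : Vec p) : 0 ≤ l1Norm δ := Finset.sum_nonneg fun _ _ => abs_nonneg _

lemma inner_eq_sum {p : ℕ} (x θ : Vec p) : (inner ℝ x θ : ℝ) = ∑ j, x j * θ j := by
  simp [PiLp.inner_apply, mul_comm]

/-- Duality of `ℓ¹` and `ℓ^∞`, in exponential form. -/
lemma exp_sum_mul_le {p : ℕ} (hp : 0 < p) {δ : Vec p} {Δ : ℝ} (hδ : l1Norm δ ≤ Δ)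
    (c : Fin p → ℝ) :
    Real.exp (∑ j, δ j * c j) ≤ ∑ j, (Real.exp (Δ * c j) + Real.exp (-(Δ * c j))) := by
  have : Nonempty (Fin p) := ⟨⟨0, hp⟩⟩
  have hΔ : 0 ≤ Δ := (l1Norm_nonneg δ).trans hδ
  obtain ⟨k, hk⟩ := Finite.exists_max fun j => |c j|
  have h1 : ∑ j, δ j * c j ≤ Δ * |c k| := by
    calc ∑ j, δ j * c j ≤ ∑ j, |δ j| * |c k| := Finset.sum_le_sum fun j _ =>
          (le_abs_self _).trans (by rw [abs_mul]; exact mul_le_mul_of_nonneg_left (hk j) (abs_nonneg _))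
      _ = l1Norm δ * |c k| := by rw [l1Norm, Finset.sum_mul]
      _ ≤ Δ * |c k| := by gcongr
  have h2 : Real.exp (Δ * |c k|) ≤ Real.exp (Δ * c k) + Real.exp (-(Δ * c k)) := by
    rcases abs_cases (c k) with h | h <;> rw [h.1]
    · linarith [Real.exp_pos (-(Δ * c k))]
    · rw [mul_neg]; linarith [Real.exp_pos (Δ * c k)]
  exact (Real.exp_le_exp.2 h1).trans <| h2.trans <|
    Finset.single_le_sum (f := fun j => Real.exp (Δ * c j) + Real.exp (-(Δ * c j)))
      (fun j _ => by positivity) (Finset.mem_univ k)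

section Tail

variable {n p : ℕ} {F : Finset (Vec p)} {x : Fin n → Vec p} {ℓ : Fin n → ℝ}
  {f : Fin n → Vec p → ℝ} {Δ V : ℝ}

/-- Chernoff bound for one side of the supremum of a Rademacher process whose summands are
Lipschitz functions, vanishing at zero, of the linear predictors `xᵢᵀδ`. -/
lemma card_signs_one_sided (hp : 0 < p) (hΔ : 0 < Δ) (hV : 0 < V)
    (hℓ : ∀ i, 0 ≤ ℓ i)
    (hlip : ∀ i, ∀ s ∈ F, ∀ t ∈ F,
      |f i s - f i t| ≤ ℓ i * |inner ℝ (x i) s - inner ℝ (x i) t|)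
    (hzero : ∀ i, ∀ t ∈ F, |f i t| ≤ ℓ i * |inner ℝ (x i) t|)
    (hF : ∀ t ∈ F, l1Norm t ≤ Δ) (hVx : ∀ j, ∑ i, (ℓ i * x i j) ^ 2 ≤ V)
    {y : ℝ} (hy : 0 ≤ y) :
    ((Finset.univ.filter fun ε : Fin n → Bool =>
      ∃ t ∈ F, y < ∑ i, signVal (ε i) * f i t).card : ℝ) ≤
      2 ^ n * (2 * p * Real.exp (-y ^ 2 / (2 * Δ ^ 2 * V))) := by
  rcases F.eq_empty_or_nonempty with rfl | hne
  · simp; positivity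
  -- the minimizer of the Chernoff exponent
  set r : ℝ := y / (Δ ^ 2 * V) with hr
  have hr0 : 0 ≤ r := by positivity
  have hmarkov : ((Finset.univ.filter fun ε : Fin n → Bool =>
      ∃ t ∈ F, y < ∑ i, signVal (ε i) * f i t).card : ℝ) * Real.exp (r * y) ≤
      ∑ ε : Fin n → Bool,
        Real.exp (F.sup' hne fun t => 0 + ∑ i, signVal (ε i) * (r * f i t)) := by
    rw [← nsmul_eq_mul, ← Finset.sum_const]
    refine (Finset.sum_le_sum fun ε hε => ?_).trans
      (Finset.sum_le_univ_sum_of_nonneg fun ε => (Real.exp_pos _).le)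
    obtain ⟨t, ht, hyt⟩ := (Finset.mem_filter.1 hε).2
    refine Real.exp_le_exp.2 ?_
    refine le_trans ?_ (Finset.le_sup' (fun t => 0 + ∑ i, signVal (ε i) * (r * f i t)) ht)
    calc r * y ≤ r * ∑ i, signVal (ε i) * f i t := by gcongr
      _ = 0 + ∑ i, signVal (ε i) * (r * f i t) := by
        rw [Finset.mul_sum, zero_add]; exact Finset.sum_congr rfl fun i _ => by ring
  have hcontr := rademacher_contraction hne (fun _ => 0)
    (fun i t => r * (ℓ i * inner ℝ (x i) t)) (fun i t => r * f i t)
    (fun i s hs t ht => by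
      rw [← mul_sub, ← mul_sub, ← mul_sub, abs_mul, abs_mul, abs_mul (ℓ i), abs_of_nonneg (hℓ i)]
      gcongr
      exact hlip i s hs t ht)
    (fun i t ht => by
      rw [abs_mul, abs_mul, abs_mul (ℓ i), abs_of_nonneg (hℓ i)]
      gcongr
      exact hzero i t ht)
  have hdual : ∑ ε : Fin n → Bool, Real.exp (F.sup' hne fun t =>
      0 + ∑ i, signVal (ε i) * (r * (ℓ i * inner ℝ (x i) t))) ≤
      ∑ ε : Fin n → Bool, ∑ j : Fin p,
        (Real.exp (∑ i, signVal (ε i) * (Δ * r * (ℓ i * x i j))) +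
          Real.exp (∑ i, signVal (ε i) * (-(Δ * r * (ℓ i * x i j))))) := by
    refine Finset.sum_le_sum fun ε _ => ?_
    obtain ⟨t, ht, hsup⟩ := F.exists_mem_eq_sup' hne fun t =>
      0 + ∑ i, signVal (ε i) * (r * (ℓ i * inner ℝ (x i) t))
    rw [hsup]
    have h1 : 0 + ∑ i, signVal (ε i) * (r * (ℓ i * inner ℝ (x i) t)) =
        ∑ j, t j * ∑ i, signVal (ε i) * (r * (ℓ i * x i j)) := by
      simp only [inner_eq_sum, Finset.mul_sum, zero_add]
      rw [Finset.sum_comm]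
      exact Finset.sum_congr rfl fun _ _ => Finset.sum_congr rfl fun _ _ => by ring
    have h2 : ∀ j, ∑ i, signVal (ε i) * (Δ * r * (ℓ i * x i j)) =
        Δ * ∑ i, signVal (ε i) * (r * (ℓ i * x i j)) := fun j => by
      rw [Finset.mul_sum]
      exact Finset.sum_congr rfl fun _ _ => by ring
    simp only [mul_neg, Finset.sum_neg_distrib, h1, h2]
    exact exp_sum_mul_le hp (hF t ht) _
  have hmgf : ∀ j : Fin p, ∀ σ : ℝ, σ ^ 2 = 1 →
      ∑ ε : Fin n → Bool, Real.exp (∑ i, signVal (ε i) * (σ * (Δ * r * (ℓ i * x i j)))) ≤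
        2 ^ n * Real.exp (Δ ^ 2 * r ^ 2 * V / 2) := by
    intro j σ hσ
    refine (sum_signs_exp_le _).trans ?_
    gcongr
    calc ∑ i, (σ * (Δ * r * (ℓ i * x i j))) ^ 2
        = Δ ^ 2 * r ^ 2 * ∑ i, (ℓ i * x i j) ^ 2 := by
          rw [Finset.mul_sum]
          refine Finset.sum_congr rfl fun i _ => ?_
          rw [mul_pow, hσ]; ring
      _ ≤ Δ ^ 2 * r ^ 2 * V := by gcongr; exact hVx j
  have htotal : ∑ ε : Fin n → Bool, ∑ j : Fin p,
        (Real.exp (∑ i, signVal (ε i) * (Δ * r * (ℓ i * x i j))) +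
          Real.exp (∑ i, signVal (ε i) * (-(Δ * r * (ℓ i * x i j))))) ≤
      2 * p * (2 ^ n * Real.exp (Δ ^ 2 * r ^ 2 * V / 2)) := by
    rw [Finset.sum_comm]
    have : ∀ j : Fin p, ∑ ε : Fin n → Bool,
        (Real.exp (∑ i, signVal (ε i) * (Δ * r * (ℓ i * x i j))) +
          Real.exp (∑ i, signVal (ε i) * (-(Δ * r * (ℓ i * x i j))))) ≤
        2 * (2 ^ n * Real.exp (Δ ^ 2 * r ^ 2 * V / 2)) := by
      intro j
      rw [Finset.sum_add_distrib]
      have h1 := hmgf j 1 (by norm_num)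
      have h2 := hmgf j (-1) (by norm_num)
      simp only [one_mul, neg_one_mul] at h1 h2
      linarith
    refine (Finset.sum_le_sum fun j _ => this j).trans ?_
    simp only [Finset.sum_const, Finset.card_univ, Fintype.card_fin, nsmul_eq_mul]
    exact le_of_eq (by ring)
  have hall := hmarkov.trans (hcontr.trans (hdual.trans htotal))
  have hexp : Real.exp (-y ^ 2 / (2 * Δ ^ 2 * V)) =
      Real.exp (Δ ^ 2 * r ^ 2 * V / 2) * Real.exp (-(r * y)) := by
    rw [← Real.exp_add, hr]
    congr 1
    field_simp
    ring
  rw [hexp]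
  calc _ = _ * Real.exp (r * y) * Real.exp (-(r * y)) := by
        rw [mul_assoc, ← Real.exp_add, add_neg_cancel, Real.exp_zero, mul_one]
    _ ≤ 2 * p * (2 ^ n * Real.exp (Δ ^ 2 * r ^ 2 * V / 2)) * Real.exp (-(r * y)) := by gcongr
    _ = _ := by ring

/-- Sub-Gaussian tail of the supremum of the absolute value of a contracted Rademacher process. -/
lemma card_signs_two_sided (hp : 0 < p) (hΔ : 0 < Δ) (hV : 0 < V)
    (hℓ : ∀ i, 0 ≤ ℓ i)
    (hlip : ∀ i, ∀ s ∈ F, ∀ t ∈ F,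
      |f i s - f i t| ≤ ℓ i * |inner ℝ (x i) s - inner ℝ (x i) t|)
    (hzero : ∀ i, ∀ t ∈ F, |f i t| ≤ ℓ i * |inner ℝ (x i) t|)
    (hF : ∀ t ∈ F, l1Norm t ≤ Δ) (hVx : ∀ j, ∑ i, (ℓ i * x i j) ^ 2 ≤ V)
    {y : ℝ} (hy : 0 ≤ y) :
    ((Finset.univ.filter fun ε : Fin n → Bool =>
      ∃ t ∈ F, y < |∑ i, signVal (ε i) * f i t|).card : ℝ) ≤
      2 ^ n * (4 * p * Real.exp (-y ^ 2 / (2 * Δ ^ 2 * V))) := by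
  have h1 := card_signs_one_sided hp hΔ hV hℓ hlip hzero hF hVx hy
  have h2 := card_signs_one_sided (f := fun i t => -f i t) hp hΔ hV hℓ
    (fun i s hs t ht => by
      rw [neg_sub_neg, abs_sub_comm]; exact hlip i s hs t ht)
    (fun i t ht => by rw [abs_neg]; exact hzero i t ht) hF hVx hy
  have hsub : (Finset.univ.filter fun ε : Fin n → Bool =>
      ∃ t ∈ F, y < |∑ i, signVal (ε i) * f i t|) ⊆
      (Finset.univ.filter fun ε : Fin n → Bool => ∃ t ∈ F, y < ∑ i, signVal (ε i) * f i t) ∪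
      (Finset.univ.filter fun ε : Fin n → Bool => ∃ t ∈ F, y < ∑ i, signVal (ε i) * -f i t) := by
    intro ε hε
    obtain ⟨t, ht, hyt⟩ := (Finset.mem_filter.1 hε).2
    simp only [Finset.mem_union, Finset.mem_filter, Finset.mem_univ, true_and]
    rcases lt_abs.1 hyt with h | h
    · exact Or.inl ⟨t, ht, h⟩
    · refine Or.inr ⟨t, ht, ?_⟩
      simpa only [mul_neg, Finset.sum_neg_distrib] using h
  have hcard := (Finset.card_le_card hsub).trans (Finset.card_union_le _ _)
  have hcard' := (Nat.cast_le (α := ℝ)).2 hcard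
  push_cast at hcard'
  linarith

end Tail

/-! ### Symmetrization for independent samples -/

section Symmetrization

open scoped ENNReal

variable {S : Type*} [MeasurableSpace S] {P : Measure S} [IsProbabilityMeasure P] {n : ℕ}

lemma chebyshev_pi {g : S → ℝ} (hg : MemLp g 2 P) {t : ℝ} (ht : 0 < t) :
    Measure.pi (fun _ : Fin n => P) {w | t ≤ |∑ i, g (w i) - n * ∫ z, g z ∂P|} ≤
      ENNReal.ofReal (n * (∫ z, g z ^ 2 ∂P) / t ^ 2) := by
  set ν := Measure.pi (fun _ : Fin n => P)
  have hcomp : ∀ i : Fin n, MemLp (fun w : Fin n → S => g (w i)) 2 ν := fun i =>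
    hg.comp_measurePreserving (measurePreserving_eval _ i)
  have hsum : MemLp (∑ i : Fin n, fun w : Fin n → S => g (w i)) 2 ν :=
    memLp_finsetSum' _ fun i _ => hcomp i
  have hmean : ∫ w, (∑ i : Fin n, fun w : Fin n → S => g (w i)) w ∂ν = n * ∫ z, g z ∂P := by
    simp only [Finset.sum_apply]
    rw [integral_finsetSum _ fun i _ => (hcomp i).integrable (by norm_num)]
    have : ∀ i : Fin n, ∫ w, g (w i) ∂ν = ∫ z, g z ∂P := fun i =>
      integral_comp_eval (μ := fun _ : Fin n => P) hg.aestronglyMeasurable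
    simp [this]
  have h := meas_ge_le_variance_div_sq hsum ht
  rw [hmean, variance_sum_pi fun _ => hg] at h
  simp only [Finset.sum_apply, Finset.sum_const, Finset.card_univ, Fintype.card_fin,
    nsmul_eq_mul] at h
  refine h.trans (ENNReal.ofReal_le_ofReal ?_)
  gcongr
  exact variance_le_expectation_sq hg.aestronglyMeasurable

variable {ι : Type*} {F : Finset ι} {f : ι → S → ℝ}

lemma measurableSet_exists_lt_abs {α : Type*} [MeasurableSpace α] {g : ι → α → ℝ}
    (hg : ∀ t ∈ F, Measurable (g t)) (y : ℝ) : MeasurableSet {a | ∃ t ∈ F, y < |g t a|} := by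
  have : {a | ∃ t ∈ F, y < |g t a|} = ⋃ t ∈ F, {a | y < |g t a|} := by ext; simp
  rw [this]
  exact F.measurableSet_biUnion fun t ht => measurableSet_lt measurable_const (hg t ht).abs

/-- A sample and its independent copy may be exchanged coordinate by coordinate, so that the
difference of their sums is distributed like its randomly signed version. -/
lemma measure_pair_le_rademacher (hf : ∀ t ∈ F, Measurable (f t)) (y : ℝ) (ε : Fin n → Bool) :
    (Measure.pi fun _ : Fin n => P).prod (Measure.pi fun _ : Fin n => P)
        {z | ∃ t ∈ F, y < |∑ i, (f t (z.1 i) - f t (z.2 i))|} ≤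
      2 * Measure.pi (fun _ : Fin n => P)
        {w | ∃ t ∈ F, y / 2 < |∑ i, signVal (ε i) * f t (w i)|} := by
  set Q := Measure.pi fun _ : Fin n => P.prod P
  have hdiff : ∀ b : Bool, ∀ t ∈ F,
      Measurable fun u : S × S => signVal b * (f t u.1 - f t u.2) := fun b t ht =>
    (((hf t ht).comp measurable_fst).sub ((hf t ht).comp measurable_snd)).const_mul _
  have hDmeas : ∀ ε : Fin n → Bool, MeasurableSet {u : Fin n → S × S |
      ∃ t ∈ F, y < |∑ i, signVal (ε i) * (f t (u i).1 - f t (u i).2)|} := fun ε =>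
    measurableSet_exists_lt_abs (fun t ht => Finset.measurable_sum _ fun i _ =>
      (hdiff (ε i) t ht).comp (measurable_pi_apply i)) y
  have hHmeas : MeasurableSet {w : Fin n → S |
      ∃ t ∈ F, y / 2 < |∑ i, signVal (ε i) * f t (w i)|} :=
    measurableSet_exists_lt_abs (fun t ht => Finset.measurable_sum _ fun i _ =>
      ((hf t ht).comp (measurable_pi_apply i)).const_mul _) _
  have hpair : (Measure.pi fun _ : Fin n => P).prod (Measure.pi fun _ : Fin n => P)
      {z | ∃ t ∈ F, y < |∑ i, (f t (z.1 i) - f t (z.2 i))|} =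
      Q {u | ∃ t ∈ F, y < |∑ i, (f t (u i).1 - f t (u i).2)|} := by
    rw [← (measurePreserving_arrowProdEquivProdArrow S S (Fin n)
      (fun _ => P) fun _ => P).measure_preimage_equiv]
    rfl
  have hswap : MeasurePreserving
      (fun (u : Fin n → S × S) i => (if ε i then id else Prod.swap) (u i)) Q Q := by
    refine measurePreserving_pi (fun _ => P.prod P) (fun _ => P.prod P)
      (f := fun i => if ε i then id else Prod.swap) fun i => ?_
    cases ε i
    · exact Measure.measurePreserving_swap
    · exact MeasurePreserving.id _
  have hsigned : Q {u | ∃ t ∈ F, y < |∑ i, (f t (u i).1 - f t (u i).2)|} =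
      Q {u | ∃ t ∈ F, y < |∑ i, signVal (ε i) * (f t (u i).1 - f t (u i).2)|} := by
    have h1 := hDmeas fun _ => true
    simp only [signVal, cond_true, one_mul] at h1
    rw [← hswap.measure_preimage h1.nullMeasurableSet]
    congr 1
    ext u
    simp only [Set.mem_preimage, Set.mem_ofPred_eq]
    refine exists_congr fun t => and_congr_right fun _ => ?_
    have : ∀ i, f t ((if ε i then id else Prod.swap) (u i)).1 -
        f t ((if ε i then id else Prod.swap) (u i)).2 =
        signVal (ε i) * (f t (u i).1 - f t (u i).2) := by
      intro i
      cases ε i <;> simp [signVal]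
    simp only [this]
  have hfst : MeasurePreserving (fun (u : Fin n → S × S) i => (u i).1) Q
      (Measure.pi fun _ : Fin n => P) :=
    measurePreserving_pi (fun _ => P.prod P) (fun _ => P) fun _ => measurePreserving_fst
  have hsnd : MeasurePreserving (fun (u : Fin n → S × S) i => (u i).2) Q
      (Measure.pi fun _ : Fin n => P) :=
    measurePreserving_pi (fun _ => P.prod P) (fun _ => P) fun _ => measurePreserving_snd
  rw [hpair, hsigned, two_mul]
  nth_rewrite 1 [← hfst.measure_preimage hHmeas.nullMeasurableSet]
  rw [← hsnd.measure_preimage hHmeas.nullMeasurableSet]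
  refine (measure_mono ?_).trans (measure_union_le _ _)
  rintro u ⟨t, ht, hy⟩
  simp only [Set.mem_union, Set.mem_preimage, Set.mem_ofPred_eq]
  by_contra! hcon
  have h1 := hcon.1 t ht
  have h2 := hcon.2 t ht
  have h3 := abs_sub (∑ i, signVal (ε i) * f t (u i).1) (∑ i, signVal (ε i) * f t (u i).2)
  rw [← Finset.sum_sub_distrib] at h3
  simp only [← mul_sub] at h3
  linarith

/-- Symmetrization in probability: if each centred sum is small with probability at least `3/4`,
the supremum of the centred sums is controlled by the proportion of signs for which the
Rademacher process of the sample is large, outside an exceptional set of samples. -/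
lemma symmetrization {e : ι → ℝ} (hf : ∀ t ∈ F, Measurable (f t)) {y : ℝ}
    (hpoint : ∀ t ∈ F, Measure.pi (fun _ : Fin n => P)
      {w | y ≤ |∑ i, f t (w i) - n * e t|} ≤ 1 / 4)
    {bad : Set (Fin n → S)} (hbad : MeasurableSet bad) {ρ : ℝ≥0∞}
    (hrad : ∀ w ∉ bad, ((Finset.univ.filter fun ε : Fin n → Bool =>
      ∃ t ∈ F, y / 2 < |∑ i, signVal (ε i) * f t (w i)|).card : ℝ≥0∞) ≤ 2 ^ n * ρ) :
    3 / 4 * Measure.pi (fun _ : Fin n => P) {w | ∃ t ∈ F, 2 * y < |∑ i, f t (w i) - n * e t|} ≤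
      2 * (Measure.pi (fun _ : Fin n => P) bad + ρ) := by
  set ν := Measure.pi (fun _ : Fin n => P)
  have hsum : ∀ t ∈ F, Measurable fun w : Fin n → S => ∑ i, f t (w i) := fun t ht =>
    Finset.measurable_sum _ fun i _ => (hf t ht).comp (measurable_pi_apply i)
  set E := {w : Fin n → S | ∃ t ∈ F, 2 * y < |∑ i, f t (w i) - n * e t|} with hE
  have hEmeas : MeasurableSet E :=
    measurableSet_exists_lt_abs (fun t ht => (hsum t ht).sub_const _) _
  set G := {z : (Fin n → S) × (Fin n → S) | ∃ t ∈ F, y < |∑ i, (f t (z.1 i) - f t (z.2 i))|}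
    with hG
  have hGmeas : MeasurableSet G := by
    refine measurableSet_exists_lt_abs (fun t ht => ?_) _
    simp only [Finset.sum_sub_distrib]
    exact ((hsum t ht).comp measurable_fst).sub ((hsum t ht).comp measurable_snd)
  -- a sample in `E` is far from its independent copy with probability at least `3/4`
  have hghost : 3 / 4 * ν E ≤ ν.prod ν G := by
    rw [Measure.prod_apply hGmeas, ← setLIntegral_const]
    refine (setLIntegral_mono' hEmeas fun w hw => ?_).trans (setLIntegral_le_lintegral E _)
    obtain ⟨t, ht, hwt⟩ := hw
    have hsub : {w' : Fin n → S | y ≤ |∑ i, f t (w' i) - n * e t|}ᶜ ⊆ Prod.mk w ⁻¹' G := by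
      intro w' hw'
      simp only [Set.mem_compl_iff, Set.mem_ofPred_eq, not_le] at hw'
      refine ⟨t, ht, ?_⟩
      rw [Finset.sum_sub_distrib]
      have := abs_sub_abs_le_abs_sub (∑ i, f t (w i) - n * e t) (∑ i, f t (w' i) - n * e t)
      rw [sub_sub_sub_cancel_right] at this
      linarith
    refine le_trans ?_ (measure_mono hsub)
    rw [prob_compl_eq_one_sub (measurableSet_le measurable_const ((hsum t ht).sub_const _).abs)]
    refine le_trans (le_of_eq ?_) (tsub_le_tsub_left (hpoint t ht) 1)
    refine (ENNReal.sub_eq_of_eq_add (by simp) ?_).symm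
    rw [ENNReal.div_add_div_same]
    norm_num
    exact (ENNReal.div_self (by norm_num) (by norm_num)).symm
  have hH : ∀ ε : Fin n → Bool, MeasurableSet {w : Fin n → S |
      ∃ t ∈ F, y / 2 < |∑ i, signVal (ε i) * f t (w i)|} := fun ε =>
    measurableSet_exists_lt_abs (fun t ht => Finset.measurable_sum _ fun i _ =>
      ((hf t ht).comp (measurable_pi_apply i)).const_mul _) _
  have hcount : ∑ ε : Fin n → Bool, ν {w | ∃ t ∈ F, y / 2 < |∑ i, signVal (ε i) * f t (w i)|} ≤
      2 ^ n * (ν bad + ρ) := by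
    have h1 : ∑ ε : Fin n → Bool,
        ν {w | ∃ t ∈ F, y / 2 < |∑ i, signVal (ε i) * f t (w i)|} =
        ∫⁻ w, ((Finset.univ.filter fun ε : Fin n → Bool =>
          ∃ t ∈ F, y / 2 < |∑ i, signVal (ε i) * f t (w i)|).card : ℝ≥0∞) ∂ν := by
      simp_rw [← lintegral_indicator_one (hH _)]
      rw [← lintegral_finsetSum _ fun ε _ => measurable_one.indicator (hH ε)]
      refine lintegral_congr fun w => ?_
      simp [Set.indicator_apply, Finset.sum_boole]
    rw [h1]
    calc _ ≤ ∫⁻ w, (bad.indicator (fun _ => 2 ^ n) w + 2 ^ n * ρ) ∂ν := by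
          refine lintegral_mono fun w => ?_
          by_cases hw : w ∈ bad
          · rw [Set.indicator_of_mem hw]
            refine le_add_right ?_
            have := Finset.card_filter_le (Finset.univ : Finset (Fin n → Bool)) fun ε =>
              ∃ t ∈ F, y / 2 < |∑ i, signVal (ε i) * f t (w i)|
            simp only [Finset.card_univ, Fintype.card_pi, Fintype.card_bool, Finset.prod_const,
              Fintype.card_fin] at this
            exact_mod_cast this
          · exact le_add_left (hrad w hw)
      _ = 2 ^ n * (ν bad + ρ) := by
          rw [lintegral_add_left (measurable_const.indicator hbad), lintegral_indicator hbad,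
            setLIntegral_const, lintegral_const, measure_univ, mul_one, mul_add]
  have hsymm : 2 ^ n * ν.prod ν G ≤ 2 ^ n * (2 * (ν bad + ρ)) := by
    calc 2 ^ n * ν.prod ν G = ∑ _ε : Fin n → Bool, ν.prod ν G := by simp
      _ ≤ ∑ ε : Fin n → Bool,
          2 * ν {w | ∃ t ∈ F, y / 2 < |∑ i, signVal (ε i) * f t (w i)|} :=
        Finset.sum_le_sum fun ε _ => measure_pair_le_rademacher hf y ε
      _ = 2 * ∑ ε : Fin n → Bool,
          ν {w | ∃ t ∈ F, y / 2 < |∑ i, signVal (ε i) * f t (w i)|} := by rw [Finset.mul_sum]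
      _ ≤ 2 * (2 ^ n * (ν bad + ρ)) := by gcongr
      _ = 2 ^ n * (2 * (ν bad + ρ)) := by ring
  exact hghost.trans ((ENNReal.mul_le_mul_iff_right (by simp) (by simp)).1 hsymm)

lemma measure_biUnion_le_of_finset {α : Type*} [MeasurableSpace α] {ν : Measure α}
    {c : Set ι} (hc : c.Countable) (E : ι → Set α) {K : ℝ≥0∞}
    (h : ∀ F : Finset ι, ↑F ⊆ c → ν (⋃ t ∈ F, E t) ≤ K) : ν (⋃ t ∈ c, E t) ≤ K := by
  classical
  have := hc.to_subtype
  have hunion : ⋃ t ∈ c, E t = ⋃ F : Finset c, ⋃ t ∈ F, E t := by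
    ext a
    simp only [Set.mem_iUnion]
    constructor
    · rintro ⟨t, ht, ha⟩
      exact ⟨{⟨t, ht⟩}, ⟨t, ht⟩, by simp, ha⟩
    · rintro ⟨F, t, -, ha⟩
      exact ⟨t, t.2, ha⟩
  have hdir : Directed (· ⊆ ·) fun F : Finset c => ⋃ t ∈ F, E (t : ι) := by
    refine Monotone.directed_le fun F F' hF => ?_
    exact Set.biUnion_subset_biUnion_left hF
  rw [hunion, hdir.measure_iUnion]
  refine iSup_le fun F => ?_
  refine le_trans (measure_mono ?_) (h (F.map (Function.Embedding.subtype _)) ?_)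
  · intro a ha
    simp only [Set.mem_iUnion] at ha ⊢
    obtain ⟨t, ht, ha⟩ := ha
    exact ⟨t, Finset.mem_map_of_mem _ ht, ha⟩
  · intro t ht
    simp only [Finset.coe_map, Set.mem_image] at ht
    obtain ⟨t, -, rfl⟩ := ht
    exact t.2

end Symmetrization

/-! ### Conditional Hoeffding bound for the score -/

section ProductKernel

open scoped ENNReal

variable {α β : Type*} [MeasurableSpace α] [MeasurableSpace β] {n : ℕ}

lemma measurable_pi_kernel (κ : Kernel α β) [IsMarkovKernel κ] :
    Measurable fun x : Fin n → α => Measure.pi fun i => κ (x i) := by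
  refine Measurable.measure_of_isPiSystem_of_isProbabilityMeasure
    generateFrom_pi.symm isPiSystem_pi ?_
  rintro _ ⟨s, hs, rfl⟩
  simp only [Measure.pi_pi]
  refine Finset.measurable_fun_prod _ fun i _ => ?_
  exact (κ.measurable_coe (hs i (Set.mem_univ i))).comp (measurable_pi_apply i)

/-- The product of `n` copies of a Markov kernel, acting coordinate by coordinate. -/
def piKernel (n : ℕ) (κ : Kernel α β) [IsMarkovKernel κ] : Kernel (Fin n → α) (Fin n → β) :=
  ⟨fun x => Measure.pi fun i => κ (x i), measurable_pi_kernel κ⟩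

instance (κ : Kernel α β) [IsMarkovKernel κ] : IsMarkovKernel (piKernel n κ) :=
  ⟨fun x => inferInstanceAs (IsProbabilityMeasure (Measure.pi fun i => κ (x i)))⟩

/-- Disintegration of an independent sample: first draw all first components, then draw the second
components independently from their conditional laws. -/
lemma pi_compProd (Q : Measure α) [IsProbabilityMeasure Q] (κ : Kernel α β) [IsMarkovKernel κ] :
    Measure.pi (fun _ : Fin n => Q ⊗ₘ κ) =
      ((Measure.pi fun _ : Fin n => Q) ⊗ₘ piKernel n κ).map fun z i => (z.1 i, z.2 i) := by
  have hzip : Measurable fun (z : (Fin n → α) × (Fin n → β)) (i : Fin n) => (z.1 i, z.2 i) := by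
    fun_prop
  refine Measure.pi_eq fun s hs => ?_
  have hpi : MeasurableSet (Set.univ.pi s) := MeasurableSet.univ_pi hs
  rw [Measure.map_apply hzip hpi, Measure.compProd_apply (hzip hpi)]
  have hsec : ∀ x : Fin n → α, piKernel n κ x
      (Prod.mk x ⁻¹' ((fun (z : (Fin n → α) × (Fin n → β)) (i : Fin n) => (z.1 i, z.2 i)) ⁻¹'
        Set.univ.pi s)) = ∏ i, κ (x i) (Prod.mk (x i) ⁻¹' s i) := by
    intro x
    have : (Prod.mk x ⁻¹' ((fun (z : (Fin n → α) × (Fin n → β)) (i : Fin n) => (z.1 i, z.2 i)) ⁻¹'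
        Set.univ.pi s)) = Set.univ.pi fun i => Prod.mk (x i) ⁻¹' s i := by
      ext r; simp [Set.mem_pi]
    rw [this]
    exact Measure.pi_pi _ _
  simp_rw [hsec]
  have hmeas : ∀ i, Measurable fun a => κ a (Prod.mk a ⁻¹' s i) := fun i =>
    Kernel.measurable_kernel_prodMk_left (hs i)
  have hind := lintegral_prod_eq_prod_lintegral_of_indepFun Finset.univ
    (fun (i : Fin n) (x : Fin n → α) => κ (x i) (Prod.mk (x i) ⁻¹' s i))
    (iIndepFun_pi (μ := fun _ : Fin n => Q) (X := fun i a => κ a (Prod.mk a ⁻¹' s i))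
      fun i => (hmeas i).aemeasurable)
    fun i => (hmeas i).comp (measurable_pi_apply i)
  rw [hind]
  refine Finset.prod_congr rfl fun i _ => ?_
  rw [Measure.compProd_apply (hs i)]
  exact (measurePreserving_eval (fun _ : Fin n => Q) i).lintegral_comp (hmeas i)

end ProductKernel

section Hoeffding

variable {n : ℕ}

/-- Hoeffding's inequality for weighted sums of independent centred variables, each confined to an
interval of width `d`. -/
lemma hoeffding_pi {κ : Fin n → Measure ℝ} [∀ i, IsProbabilityMeasure (κ i)] {a b : Fin n → ℝ}
    {d : ℝ} (hmem : ∀ i, ∀ᵐ r ∂κ i, r ∈ Set.Icc (a i) (b i)) (hwidth : ∀ i, b i - a i ≤ d)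
    (hmean : ∀ i, ∫ r, r ∂κ i = 0) (x : Fin n → ℝ) {t : ℝ} (ht : 0 ≤ t) :
    (Measure.pi κ).real {r | t ≤ ∑ i, x i * r i} ≤
      Real.exp (-(2 * t ^ 2) / (d ^ 2 * ∑ i, x i ^ 2)) := by
  have hsub : ∀ i ∈ Finset.univ, HasSubgaussianMGF (fun r : Fin n → ℝ => x i * r i)
      (Real.toNNReal ((x i * (d / 2)) ^ 2)) (Measure.pi κ) := by
    intro i _
    -- the interval is enlarged to width exactly `d`, so that the variance proxy is explicit
    have hmem' : ∀ᵐ r ∂κ i, r ∈ Set.Icc (a i) (a i + d) := by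
      filter_upwards [hmem i] with r hr
      exact ⟨hr.1, by linarith [hr.2, hwidth i]⟩
    have h := hasSubgaussianMGF_of_mem_Icc (μ := Measure.pi κ) (X := fun r => r i)
      (measurable_pi_apply i).aemeasurable
      ((measurePreserving_eval κ i).quasiMeasurePreserving.ae hmem')
    have hm : ∫ r : Fin n → ℝ, r i ∂Measure.pi κ = 0 := by
      rw [integral_comp_eval (μ := κ) (f := fun r : ℝ => r) aestronglyMeasurable_id, hmean i]
    simp only [hm, sub_zero] at h
    convert h.const_mul (x i) using 1
    refine NNReal.eq ?_
    rw [Real.coe_toNNReal _ (sq_nonneg _)]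
    change _ = x i ^ 2 * (‖a i + d - a i‖ / 2) ^ 2
    rw [add_sub_cancel_left, Real.norm_eq_abs, mul_pow, div_pow, div_pow, sq_abs]
  have hind : iIndepFun (fun i (r : Fin n → ℝ) => x i * r i) (Measure.pi κ) :=
    iIndepFun_pi (X := fun i r => x i * r) fun i => (measurable_const_mul (x i)).aemeasurable
  refine (HasSubgaussianMGF.measure_sum_ge_le_of_iIndepFun hind hsub ht).trans (le_of_eq ?_)
  rw [NNReal.coe_sum]
  simp only [Real.coe_toNNReal _ (sq_nonneg _)]
  simp only [mul_pow, ← Finset.sum_mul]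
  congr 1
  rw [show 2 * ((∑ i, x i ^ 2) * (d / 2) ^ 2) = d ^ 2 * (∑ i, x i ^ 2) / 2 by ring,
    div_div_eq_mul_div]
  ring

/-- The two-sided bound, at the self-normalized level `d √((L/2) ∑ xᵢ²)`. The inequality is strict
because the level vanishes when all weights do. -/
lemma hoeffding_pi_selfNormalized {κ : Fin n → Measure ℝ} [∀ i, IsProbabilityMeasure (κ i)]
    {a b : Fin n → ℝ} {d : ℝ} (hd : 0 < d) (hmem : ∀ i, ∀ᵐ r ∂κ i, r ∈ Set.Icc (a i) (b i))
    (hwidth : ∀ i, b i - a i ≤ d) (hmean : ∀ i, ∫ r, r ∂κ i = 0) (x : Fin n → ℝ)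
    {L : ℝ} (hL : 0 ≤ L) :
    Measure.pi κ {r | d * Real.sqrt (L / 2 * ∑ i, x i ^ 2) < |∑ i, x i * r i|} ≤
      ENNReal.ofReal (2 * Real.exp (-L)) := by
  have hV0 : 0 ≤ ∑ i, x i ^ 2 := Finset.sum_nonneg fun i _ => sq_nonneg _
  rcases hV0.eq_or_lt with hV | hV
  · have hx : ∀ i, x i = 0 := fun i => by
      have := (Finset.sum_eq_zero_iff_of_nonneg fun i _ => sq_nonneg (x i)).1 hV.symm i
        (Finset.mem_univ i)
      exact pow_eq_zero_iff (two_ne_zero) |>.1 this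
    simp [hx]
  set t := d * Real.sqrt (L / 2 * ∑ i, x i ^ 2) with ht
  have ht0 : 0 ≤ t := by positivity
  have hexp : ∀ y : Fin n → ℝ, ∑ i, y i ^ 2 = ∑ i, x i ^ 2 →
      Real.exp (-(2 * t ^ 2) / (d ^ 2 * ∑ i, y i ^ 2)) = Real.exp (-L) := by
    intro y hy
    rw [hy, ht, mul_pow, Real.sq_sqrt (by positivity)]
    congr 1
    field_simp
  have h1 := hoeffding_pi hmem hwidth hmean x ht0
  have h2 := hoeffding_pi hmem hwidth hmean (fun i => -x i) ht0
  rw [hexp _ rfl] at h1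
  rw [hexp _ (by simp)] at h2
  refine ENNReal.le_ofReal_iff_toReal_le (measure_ne_top _ _) (by positivity) |>.2 ?_
  refine (measureReal_mono (?_ : _ ⊆ {r | t ≤ ∑ i, x i * r i} ∪
    {r : Fin n → ℝ | t ≤ ∑ i, -x i * r i})).trans ((measureReal_union_le _ _).trans ?_)
  · intro r hr
    rw [Set.mem_ofPred_eq] at hr
    rcases lt_abs.1 hr with h | h
    · exact Or.inl h.le
    · refine Or.inr ?_
      simp only [Set.mem_ofPred_eq, neg_mul, Finset.sum_neg_distrib]
      exact h.le
  · linarith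

end Hoeffding

/-- The coordinates of the score, normalized by the second moments of the regressors, are uniformly
small with probability at least `1 - α`; this holds conditionally on the regressors. -/
lemma measure_score_le {n p : ℕ} (hp : 0 < p) {𝒴 : Type*} [MeasurableSpace 𝒴]
    {P : Measure (Vec p × 𝒴)} [IsProbabilityMeasure P] {r : Vec p × 𝒴 → ℝ} (hr : Measurable r)
    (hint : Integrable r P)
    (hmean : P[r | MeasurableSpace.comap Prod.fst (inferInstance : MeasurableSpace (Vec p))]
      =ᵐ[P] 0)
    {rlo rhi : Vec p → ℝ} (hlo : Measurable rlo) (hhi : Measurable rhi) {d : ℝ} (hd : 0 < d)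
    (hmem : ∀ᵐ w ∂P, r w ∈ Set.Icc (rlo w.1) (rhi w.1) ∧ rhi w.1 - rlo w.1 ≤ d)
    {α : ℝ} (hα : α ∈ Set.Ioo (0 : ℝ) 1) :
    Measure.pi (fun _ : Fin n => P) {w | ∃ j, d * Real.sqrt (Real.log (2 * p / α) / 2 *
        ∑ i, (w i).1 j ^ 2) < |∑ i, (w i).1 j * r (w i)|} ≤ ENNReal.ofReal α := by
  set L := Real.log (2 * p / α) with hLdef
  have hp1 : (1 : ℝ) ≤ p := by exact_mod_cast hp
  have hL : 0 ≤ L := Real.log_nonneg (by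
    rw [le_div_iff₀ hα.1]; linarith [hα.2])
  set Q := P.map Prod.fst with hQ
  have : IsProbabilityMeasure Q := Measure.isProbabilityMeasure_map measurable_fst.aemeasurable
  set κ := condDistrib r Prod.fst P
  have hpairmeas : Measurable fun w : Vec p × 𝒴 => (w.1, r w) := measurable_fst.prodMk hr
  have hjoint : Q ⊗ₘ κ = P.map fun w => (w.1, r w) := compProd_map_condDistrib hr.aemeasurable
  have hκmem : ∀ᵐ x ∂Q, ∀ᵐ y ∂κ x, y ∈ Set.Icc (rlo x) (rhi x) ∧ rhi x - rlo x ≤ d := by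
    refine Measure.ae_ae_of_ae_compProd
      (p := fun z : Vec p × ℝ => z.2 ∈ Set.Icc (rlo z.1) (rhi z.1) ∧ rhi z.1 - rlo z.1 ≤ d) ?_
    rw [hjoint, ae_map_iff hpairmeas.aemeasurable]
    · exact hmem
    · exact ((measurableSet_le (hlo.comp measurable_fst) measurable_snd).inter
        (measurableSet_le measurable_snd (hhi.comp measurable_fst))).inter
        (measurableSet_le ((hhi.comp measurable_fst).sub (hlo.comp measurable_fst))
          measurable_const)
  have hκmean : ∀ᵐ x ∂Q, ∫ y, y ∂κ x = 0 := by
    have hmeas : StronglyMeasurable fun x => ∫ y, y ∂κ x :=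
      StronglyMeasurable.integral_kernel (f := fun y : ℝ => y) stronglyMeasurable_id
    have hset : MeasurableSet {x | ∫ y, y ∂κ x = 0} :=
      hmeas.measurable (measurableSet_singleton 0)
    rw [hQ, ae_map_iff measurable_fst.aemeasurable hset]
    filter_upwards [condExp_ae_eq_integral_condDistrib' measurable_fst hint, hmean] with w h1 h2
    rw [← h1, h2]; rfl
  have hone : ∀ j : Fin p, Measure.pi (fun _ : Fin n => P) {w | d * Real.sqrt (L / 2 *
      ∑ i, (w i).1 j ^ 2) < |∑ i, (w i).1 j * r (w i)|} ≤ ENNReal.ofReal (2 * Real.exp (-L)) := by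
    intro j
    set bad : Set (Fin n → Vec p × ℝ) :=
      {z | d * Real.sqrt (L / 2 * ∑ i, (z i).1 j ^ 2) < |∑ i, (z i).1 j * (z i).2|}
    have hbad : MeasurableSet bad := by
      refine measurableSet_lt ?_ ?_ <;> fun_prop
    have hzip : Measurable
        fun (z : (Fin n → Vec p) × (Fin n → ℝ)) (i : Fin n) => (z.1 i, z.2 i) := by fun_prop
    have hmap : (Measure.pi fun _ : Fin n => P).map (fun w i => ((w i).1, r (w i))) =
        Measure.pi fun _ : Fin n => Q ⊗ₘ κ := by
      rw [hjoint]
      have : IsProbabilityMeasure (P.map fun w => (w.1, r w)) :=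
        Measure.isProbabilityMeasure_map hpairmeas.aemeasurable
      exact Measure.pi_map_pi fun _ => hpairmeas.aemeasurable
    have hsample : Measurable fun (w : Fin n → Vec p × 𝒴) i => ((w i).1, r (w i)) :=
      measurable_pi_lambda _ fun i => hpairmeas.comp (measurable_pi_apply i)
    calc _ = (Measure.pi fun _ : Fin n => P).map (fun w i => ((w i).1, r (w i))) bad :=
          (Measure.map_apply hsample hbad).symm
      _ = ∫⁻ x, piKernel n κ x (Prod.mk x ⁻¹' ((fun z i => (z.1 i, z.2 i)) ⁻¹' bad))
          ∂Measure.pi fun _ => Q := by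
        rw [hmap, pi_compProd, Measure.map_apply hzip hbad, Measure.compProd_apply (hzip hbad)]
      _ ≤ ∫⁻ _, ENNReal.ofReal (2 * Real.exp (-L)) ∂Measure.pi fun _ : Fin n => Q := by
        refine lintegral_mono_ae ?_
        have hall : ∀ᵐ x ∂Measure.pi fun _ : Fin n => Q, ∀ i,
            (∀ᵐ y ∂κ (x i), y ∈ Set.Icc (rlo (x i)) (rhi (x i)) ∧ rhi (x i) - rlo (x i) ≤ d) ∧
              ∫ y, y ∂κ (x i) = 0 :=
          ae_all_iff.2 fun i => (measurePreserving_eval (fun _ : Fin n => Q)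
            i).quasiMeasurePreserving.ae (hκmem.and hκmean)
        filter_upwards [hall] with x hx
        exact hoeffding_pi_selfNormalized hd (fun i => (hx i).1.mono fun y hy => hy.1)
          (fun i => by
            obtain ⟨y, hy⟩ := (hx i).1.exists
            exact hy.2) (fun i => (hx i).2) (fun i => x i j) hL
      _ = ENNReal.ofReal (2 * Real.exp (-L)) := by simp
  have hunion : {w : Fin n → Vec p × 𝒴 | ∃ j, d * Real.sqrt (L / 2 *
        ∑ i, (w i).1 j ^ 2) < |∑ i, (w i).1 j * r (w i)|} =
      ⋃ j, {w | d * Real.sqrt (L / 2 * ∑ i, (w i).1 j ^ 2) < |∑ i, (w i).1 j * r (w i)|} := by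
    ext; simp
  rw [hunion]
  refine (measure_iUnion_fintype_le _ _).trans ((Finset.sum_le_sum fun j _ => hone j).trans ?_)
  rw [Finset.sum_const, Finset.card_univ, Fintype.card_fin, nsmul_eq_mul,
    ← ENNReal.ofReal_natCast, ← ENNReal.ofReal_mul (by positivity)]
  refine ENNReal.ofReal_le_ofReal (le_of_eq ?_)
  rw [hLdef, Real.exp_neg, Real.exp_log (by have := hα.1; positivity)]
  field_simp

/-! ### Convexity and sparsity: the deterministic argument -/

section Deterministic

variable {p n : ℕ} {𝒴 : Type*}

lemma add_mul_deriv_le_of_convexOn {φ : ℝ → ℝ} (hφ : ConvexOn ℝ Set.univ φ) {x : ℝ}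
    (hx : DifferentiableAt ℝ φ x) (y : ℝ) : φ x + deriv φ x * (y - x) ≤ φ y := by
  rcases lt_trichotomy x y with h | rfl | h
  · have := hφ.deriv_le_slope (Set.mem_univ x) (Set.mem_univ y) h hx
    rw [slope_def_field, le_div_iff₀ (sub_pos.2 h)] at this
    linarith
  · simp
  · have := hφ.slope_le_deriv (Set.mem_univ y) (Set.mem_univ x) h hx
    rw [slope_def_field, div_le_iff₀ (sub_pos.2 h)] at this
    linarith

lemma l1Norm_eq_add (θ₀ δ : Vec p) :
    l1Norm δ = ∑ j ∈ activeSet θ₀, |δ j| + ∑ j ∈ (activeSet θ₀)ᶜ, |δ j| :=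
  (Finset.sum_add_sum_compl _ _).symm

lemma sum_activeSet_le (θ₀ δ : Vec p) :
    ∑ j ∈ activeSet θ₀, |δ j| ≤ Real.sqrt (sparsity θ₀) * ‖δ‖ := by
  have h1 := sq_sum_le_card_mul_sum_sq (s := activeSet θ₀) (f := fun j => |δ j|)
  have h2 : ∑ j ∈ activeSet θ₀, |δ j| ^ 2 ≤ ‖δ‖ ^ 2 := by
    rw [EuclideanSpace.norm_sq_eq]
    simp only [Real.norm_eq_abs]
    exact Finset.sum_le_univ_sum_of_nonneg fun j => sq_nonneg _
  refine abs_le_of_sq_le_sq' ?_ (by positivity) |>.2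
  rw [mul_pow, Real.sq_sqrt (Nat.cast_nonneg _)]
  exact h1.trans (mul_le_mul_of_nonneg_left h2 (Nat.cast_nonneg _))

lemma l1Norm_le_of_mem_restrictedSet {Θ : Set (Vec p)} {θ₀ δ : Vec p} {c : ℝ} (hc : 0 ≤ c)
    (hδ : δ ∈ restrictedSet Θ θ₀ c) :
    l1Norm δ ≤ (1 + c) * Real.sqrt (sparsity θ₀) * ‖δ‖ := by
  have h1 := sum_activeSet_le θ₀ δ
  have h2 := hδ.1
  rw [l1Norm_eq_add θ₀]
  nlinarith

/-- The loss in `ℓ¹` norm of a perturbation of `θ₀` comes from the active coordinates alone. -/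
lemma l1Norm_sub_le (θ₀ δ : Vec p) :
    l1Norm θ₀ - l1Norm (θ₀ + δ) ≤
      ∑ j ∈ activeSet θ₀, |δ j| - ∑ j ∈ (activeSet θ₀)ᶜ, |δ j| := by
  rw [l1Norm_eq_add θ₀ θ₀, l1Norm_eq_add θ₀ (θ₀ + δ)]
  have h1 : ∑ j ∈ activeSet θ₀, |θ₀ j| ≤
      ∑ j ∈ activeSet θ₀, |(θ₀ + δ) j| + ∑ j ∈ activeSet θ₀, |δ j| := by
    rw [← Finset.sum_add_distrib]
    refine Finset.sum_le_sum fun j _ => ?_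
    have := abs_sub (θ₀ j + δ j) (δ j)
    rwa [add_sub_cancel_right] at this
  have hzero : ∀ j ∈ (activeSet θ₀)ᶜ, θ₀ j = 0 := by
    intro j hj
    by_contra h
    exact Finset.mem_compl.1 hj (Finset.mem_filter.2 ⟨Finset.mem_univ j, h⟩)
  have h2 : ∑ j ∈ (activeSet θ₀)ᶜ, |θ₀ j| = 0 :=
    Finset.sum_eq_zero fun j hj => by rw [hzero j hj, abs_zero]
  have h3 : ∑ j ∈ (activeSet θ₀)ᶜ, |(θ₀ + δ) j| = ∑ j ∈ (activeSet θ₀)ᶜ, |δ j| :=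
    Finset.sum_congr rfl fun j hj => by rw [PiLp.add_apply, hzero j hj, zero_add]
  linarith

lemma l1Norm_smul (t : ℝ) (δ : Vec p) : l1Norm (t • δ) = |t| * l1Norm δ := by
  simp [l1Norm, abs_mul, Finset.mul_sum]

lemma l1Norm_add_le (δ δ' : Vec p) : l1Norm (δ + δ') ≤ l1Norm δ + l1Norm δ' := by
  rw [l1Norm, l1Norm, l1Norm, ← Finset.sum_add_distrib]
  exact Finset.sum_le_sum fun j _ => abs_add_le _ _

variable {m : ℝ → 𝒴 → ℝ} {w : Fin n → Vec p × 𝒴} {Θ : Set (Vec p)} {θ₀ θ : Vec p}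

/-- The first-order lower bound for the convex empirical risk, the gradient at `θ₀` being the
score. -/
lemma score_le_empiricalRisk_sub (hconv : ∀ y, ConvexOn ℝ Set.univ fun t => m t y)
    (hdiff : ∀ i, DifferentiableAt ℝ (fun t => m t (w i).2) (inner ℝ (w i).1 θ₀)) (θ : Vec p) :
    ∑ j, (θ - θ₀) j * ((1 / (n : ℝ)) * ∑ i, (w i).1 j * residual m θ₀ (w i)) ≤
      empiricalRisk m w θ - empiricalRisk m w θ₀ := by
  have h : ∀ i, ∑ j, (θ - θ₀) j * ((w i).1 j * residual m θ₀ (w i)) ≤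
      lossAt m θ (w i) - lossAt m θ₀ (w i) := by
    intro i
    have := add_mul_deriv_le_of_convexOn (hconv (w i).2) (hdiff i) (inner ℝ (w i).1 θ)
    rw [← inner_sub_right] at this
    have hrw : ∑ j, (θ - θ₀) j * ((w i).1 j * residual m θ₀ (w i)) =
        residual m θ₀ (w i) * inner ℝ (w i).1 (θ - θ₀) := by
      rw [inner_eq_sum, Finset.mul_sum]
      exact Finset.sum_congr rfl fun j _ => by ring
    rw [hrw, lossAt, lossAt, residual]
    linarith
  rw [empiricalRisk, empiricalRisk, ← mul_sub, ← Finset.sum_sub_distrib]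
  calc _ = (1 / (n : ℝ)) * ∑ i, ∑ j, (θ - θ₀) j * ((w i).1 j * residual m θ₀ (w i)) := by
        rw [Finset.sum_comm, Finset.mul_sum]
        refine Finset.sum_congr rfl fun j _ => ?_
        rw [← Finset.mul_sum]; ring
    _ ≤ _ := by
        gcongr with i
        exact h i

/-- If the penalty dominates the score, the estimation error lies in the restricted set. -/
lemma sub_mem_restrictedSet (hconv : ∀ y, ConvexOn ℝ Set.univ fun t => m t y)
    (hdiff : ∀ i, DifferentiableAt ℝ (fun t => m t (w i).2) (inner ℝ (w i).1 θ₀))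
    {c₀ lam : ℝ} (hc₀ : 1 < c₀) (hlam : 0 < lam)
    (hscore : ∀ j, c₀ * |(1 / (n : ℝ)) * ∑ i, (w i).1 j * residual m θ₀ (w i)| ≤ lam)
    (hθ₀ : θ₀ ∈ Θ) (hθ : θ ∈ penalizedSolutions m Θ w lam) :
    θ - θ₀ ∈ restrictedSet Θ θ₀ (cBar c₀) := by
  refine ⟨?_, by rw [add_sub_cancel]; exact hθ.1⟩
  have hc : 0 < c₀ := by linarith
  have hmin : empiricalRisk m w θ + lam * l1Norm θ ≤ empiricalRisk m w θ₀ + lam * l1Norm θ₀ :=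
    hθ.2 hθ₀
  have hgrad := score_le_empiricalRisk_sub hconv hdiff θ
  have hl1 := l1Norm_sub_le θ₀ (θ - θ₀)
  rw [add_sub_cancel] at hl1
  have hlow : -(lam / c₀ * l1Norm (θ - θ₀)) ≤
      ∑ j, (θ - θ₀) j * ((1 / (n : ℝ)) * ∑ i, (w i).1 j * residual m θ₀ (w i)) := by
    rw [l1Norm, Finset.mul_sum, ← Finset.sum_neg_distrib]
    refine Finset.sum_le_sum fun j _ => ?_
    have h1 : |(1 / (n : ℝ)) * ∑ i, (w i).1 j * residual m θ₀ (w i)| ≤ lam / c₀ := by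
      rw [le_div_iff₀ hc, mul_comm]; exact hscore j
    have h2 := neg_abs_le ((θ - θ₀) j * ((1 / (n : ℝ)) * ∑ i, (w i).1 j * residual m θ₀ (w i)))
    rw [abs_mul] at h2
    have h3 := mul_le_mul_of_nonneg_left h1 (abs_nonneg ((θ - θ₀) j))
    linarith
  rw [l1Norm_eq_add θ₀] at hlow
  set a := ∑ j ∈ activeSet θ₀, |(θ - θ₀) j|
  set b := ∑ j ∈ (activeSet θ₀)ᶜ, |(θ - θ₀) j|
  have h1 : lam * (b - a) ≤ lam / c₀ * (a + b) := by
    have := mul_le_mul_of_nonneg_left hl1 hlam.le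
    linarith
  have h2 : c₀ * (b - a) ≤ a + b := by
    have h3 : lam / c₀ * (a + b) = lam * ((a + b) / c₀) := by ring
    rw [h3] at h1
    have h4 := le_of_mul_le_mul_left h1 hlam
    rwa [le_div_iff₀ hc, mul_comm] at h4
  rw [cBar, div_mul_eq_mul_div, le_div_iff₀ (by linarith)]
  linarith

lemma empiricalRisk_segment_le (hconv : ∀ y, ConvexOn ℝ Set.univ fun t => m t y) {t : ℝ}
    (ht0 : 0 ≤ t) (ht1 : t ≤ 1) :
    empiricalRisk m w (θ₀ + t • (θ - θ₀)) ≤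
      (1 - t) * empiricalRisk m w θ₀ + t * empiricalRisk m w θ := by
  have h : ∀ i, lossAt m (θ₀ + t • (θ - θ₀)) (w i) ≤
      (1 - t) * lossAt m θ₀ (w i) + t * lossAt m θ (w i) := by
    intro i
    have := (hconv (w i).2).2 (Set.mem_univ (inner ℝ (w i).1 θ₀))
      (Set.mem_univ (inner ℝ (w i).1 θ)) (sub_nonneg.2 ht1) ht0 (by ring)
    simp only [smul_eq_mul] at this
    have hcomb : (inner ℝ (w i).1 (θ₀ + t • (θ - θ₀)) : ℝ) =
        (1 - t) * inner ℝ (w i).1 θ₀ + t * inner ℝ (w i).1 θ := by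
      rw [inner_add_right, inner_smul_right, inner_sub_right]; ring
    rw [lossAt, hcomb]
    exact this
  rw [empiricalRisk, empiricalRisk, empiricalRisk]
  calc _ ≤ (1 / (n : ℝ)) * ∑ i, ((1 - t) * lossAt m θ₀ (w i) + t * lossAt m θ (w i)) := by
        gcongr with i; exact h i
    _ = _ := by
        rw [Finset.sum_add_distrib, ← Finset.mul_sum, ← Finset.mul_sum]; ring

/-- If a solution is further than `u` from `θ₀` and the error lies in the restricted set, then
shrinking the error to length `u` gives a direction in which the empirical risk grows by no more
than the penalty allows. -/
lemma exists_mem_sphere_of_lt_norm (hconv : ∀ y, ConvexOn ℝ Set.univ fun t => m t y)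
    (hΘ : Convex ℝ Θ) {c lam u : ℝ} (hlam : 0 ≤ lam) (hu : 0 < u) (hθ₀ : θ₀ ∈ Θ)
    (hθ : θ ∈ penalizedSolutions m Θ w lam) (hmem : θ - θ₀ ∈ restrictedSet Θ θ₀ c)
    (hlt : u < ‖θ - θ₀‖) :
    ∃ δ ∈ restrictedSet Θ θ₀ c, ‖δ‖ = u ∧
      empiricalRisk m w (θ₀ + δ) - empiricalRisk m w θ₀ ≤
        lam * (Real.sqrt (sparsity θ₀) * u) := by
  have hpos : 0 < ‖θ - θ₀‖ := hu.trans hlt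
  set t := u / ‖θ - θ₀‖ with ht
  have ht0 : 0 < t := by positivity
  have ht1 : t ≤ 1 := (div_le_one hpos).2 hlt.le
  have hnorm : ‖t • (θ - θ₀)‖ = u := by
    rw [norm_smul, Real.norm_eq_abs, abs_of_pos ht0, ht, div_mul_cancel₀ _ hpos.ne']
  refine ⟨t • (θ - θ₀), ⟨?_, hΘ.add_smul_sub_mem hθ₀ hθ.1 ⟨ht0.le, ht1⟩⟩, hnorm, ?_⟩
  · have h := mul_le_mul_of_nonneg_left hmem.1 ht0.le
    simp only [PiLp.smul_apply, smul_eq_mul, abs_mul, abs_of_pos ht0, ← Finset.mul_sum]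
    linarith
  · have hmin : empiricalRisk m w θ + lam * l1Norm θ ≤ empiricalRisk m w θ₀ + lam * l1Norm θ₀ :=
      hθ.2 hθ₀
    have hseg := empiricalRisk_segment_le (w := w) (θ₀ := θ₀) (θ := θ) hconv ht0.le ht1
    have hl1 := l1Norm_sub_le θ₀ (t • (θ - θ₀))
    have hl1seg : l1Norm (θ₀ + t • (θ - θ₀)) ≤ (1 - t) * l1Norm θ₀ + t * l1Norm θ := by
      have : θ₀ + t • (θ - θ₀) = (1 - t) • θ₀ + t • θ := by module
      rw [this]
      refine (l1Norm_add_le _ _).trans (le_of_eq ?_)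
      rw [l1Norm_smul, l1Norm_smul, abs_of_nonneg (sub_nonneg.2 ht1), abs_of_pos ht0]
    have hact := sum_activeSet_le θ₀ (t • (θ - θ₀))
    rw [hnorm] at hact
    have hcompl : 0 ≤ ∑ j ∈ (activeSet θ₀)ᶜ, |(t • (θ - θ₀)) j| :=
      Finset.sum_nonneg fun _ _ => abs_nonneg _
    have h1 := mul_le_mul_of_nonneg_left hl1seg hlam
    have h2 := mul_le_mul_of_nonneg_left hmin ht0.le
    have h3 : lam * (l1Norm θ₀ - l1Norm (θ₀ + t • (θ - θ₀))) ≤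
        lam * (Real.sqrt (sparsity θ₀) * u) := mul_le_mul_of_nonneg_left (by linarith) hlam
    linarith

end Deterministic

section Penalty

variable {p n : ℕ} {𝒴 : Type*} {w : Fin n → Vec p × 𝒴} {c₀ d α : ℝ}

/-- The mean square of a regressor is at most the maximum over all regressors. -/
lemma sum_sq_le_iSup (w : Fin n → Vec p × 𝒴) (j : Fin p) : (1 / (n : ℝ)) * ∑ i, ((w i).1 j) ^ 2 ≤
    ⨆ j : Fin p, (1 / (n : ℝ)) * ∑ i, ((w i).1 j) ^ 2 :=
  le_ciSup (f := fun j : Fin p => (1 / (n : ℝ)) * ∑ i, ((w i).1 j) ^ 2)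
    (Set.finite_range _).bddAbove j

lemma analyticPenalty_nonneg (hc₀ : 0 ≤ c₀) (hd : 0 ≤ d) : 0 ≤ analyticPenalty c₀ d α w := by
  unfold analyticPenalty; positivity

lemma score_le_analyticPenalty (hn : 0 < n) (hc₀ : 0 ≤ c₀) (hd : 0 ≤ d)
    (hL : 0 ≤ Real.log (2 * (p : ℝ) / α)) {r : Fin n → ℝ} {j : Fin p}
    (h : |∑ i, (w i).1 j * r i| ≤
      d * Real.sqrt (Real.log (2 * p / α) / 2 * ∑ i, (w i).1 j ^ 2)) :
    c₀ * |(1 / (n : ℝ)) * ∑ i, (w i).1 j * r i| ≤ analyticPenalty c₀ d α w := by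
  have hn' : (0 : ℝ) < n := by exact_mod_cast hn
  rw [abs_mul, abs_of_nonneg (by positivity), analyticPenalty, mul_assoc c₀]
  refine mul_le_mul_of_nonneg_left ?_ hc₀
  calc 1 / (n : ℝ) * |∑ i, (w i).1 j * r i|
      ≤ 1 / (n : ℝ) * (d * Real.sqrt (Real.log (2 * p / α) / 2 * ∑ i, (w i).1 j ^ 2)) := by
        gcongr
    _ = d * Real.sqrt (Real.log (2 * p / α) / (2 * n) *
        ((1 / (n : ℝ)) * ∑ i, (w i).1 j ^ 2)) := by
        rw [show Real.log (2 * p / α) / (2 * n) * ((1 / (n : ℝ)) * ∑ i, (w i).1 j ^ 2) =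
          (1 / (n : ℝ)) ^ 2 * (Real.log (2 * p / α) / 2 * ∑ i, (w i).1 j ^ 2) by
            field_simp, Real.sqrt_mul (sq_nonneg (1 / (n : ℝ))), Real.sqrt_sq (by positivity)]
        ring
    _ ≤ _ := by
        gcongr
        exact sum_sq_le_iSup w j

lemma analyticPenalty_le (hn : 0 < n) (hp : 2 ≤ p) (hc₀ : 0 ≤ c₀) (hd : 0 ≤ d)
    (hα : α ∈ Set.Ioo (0 : ℝ) 1) {CX : ℝ} (hCX : 0 ≤ CX)
    (h : ∀ j, ∑ i, ((w i).1 j) ^ 4 ≤ (n : ℝ) * CX ^ 4) :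
    analyticPenalty c₀ d α w ≤ CLam c₀ CX d * Real.sqrt (Real.log (p / α) / n) := by
  have hn' : (0 : ℝ) < n := by exact_mod_cast hn
  have hp' : (2 : ℝ) ≤ p := by exact_mod_cast hp
  have hα0 := hα.1
  have : Nonempty (Fin p) := ⟨⟨0, by omega⟩⟩
  have hpα : (2 : ℝ) ≤ p / α := by rw [le_div_iff₀ hα0]; nlinarith [hα.2]
  have hlog : Real.log (2 * p / α) / 2 ≤ Real.log (p / α) := by
    rw [mul_div_assoc, Real.log_mul (by norm_num) (by positivity)]
    have := Real.log_le_log (by norm_num) hpα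
    linarith
  have hlog0 : 0 ≤ Real.log (2 * p / α) := Real.log_nonneg (by rw [mul_div_assoc]; linarith)
  have hsup0 : ⨆ j : Fin p, (1 / (n : ℝ)) * ∑ i, ((w i).1 j) ^ 2 ≤ CX ^ 2 := by
    refine ciSup_le fun j => ?_
    have hcs := sq_sum_le_card_mul_sum_sq (s := Finset.univ) (f := fun i => (w i).1 j ^ 2)
    simp only [Finset.card_univ, Fintype.card_fin, ← pow_mul] at hcs
    have h1 : (∑ i, (w i).1 j ^ 2) ^ 2 ≤ (n * CX ^ 2) ^ 2 :=
      hcs.trans ((mul_le_mul_of_nonneg_left (h j) hn'.le).trans (le_of_eq (by ring)))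
    have h2 := (abs_le_of_sq_le_sq' h1 (by positivity)).2
    rw [one_div, inv_mul_le_iff₀ hn']
    exact h2
  rw [analyticPenalty, CLam]
  calc _ ≤ c₀ * d * Real.sqrt (Real.log (p / α) / n * CX ^ 2) := by
        refine mul_le_mul_of_nonneg_left (Real.sqrt_le_sqrt ?_) (by positivity)
        refine mul_le_mul ?_ hsup0 ?_ (div_nonneg (by linarith) hn'.le)
        · rw [← div_div]; gcongr
        · exact Real.iSup_nonneg fun j => by positivity
    _ = _ := by
        rw [Real.sqrt_mul (div_nonneg (by linarith) hn'.le), Real.sqrt_sq hCX]; ring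

/-- The penalty vanishes only on samples without variation in the regressors. -/
lemma eq_zero_of_analyticPenalty_le_zero (hn : 0 < n) (hc₀ : 0 < c₀) (hd : 0 < d)
    (hL : 0 < Real.log (2 * (p : ℝ) / α)) (h : analyticPenalty c₀ d α w ≤ 0) (i : Fin n) :
    (w i).1 = 0 := by
  have hn' : (0 : ℝ) < n := by exact_mod_cast hn
  have h1 : Real.sqrt (Real.log (2 * (p : ℝ) / α) / (2 * (n : ℝ)) *
      ⨆ j : Fin p, (1 / (n : ℝ)) * ∑ i, ((w i).1 j) ^ 2) ≤ 0 :=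
    nonpos_of_mul_nonpos_right h (by positivity)
  rw [Real.sqrt_le_left le_rfl, zero_pow two_ne_zero] at h1
  have h2 : ⨆ j : Fin p, (1 / (n : ℝ)) * ∑ i, ((w i).1 j) ^ 2 ≤ 0 :=
    nonpos_of_mul_nonpos_right h1 (by positivity)
  ext j
  have h3 := (sum_sq_le_iSup w j).trans h2
  have h4 : ∑ i, ((w i).1 j) ^ 2 ≤ 0 := nonpos_of_mul_nonpos_right h3 (by positivity)
  have h5 := Finset.single_le_sum (f := fun i => ((w i).1 j) ^ 2) (fun i _ => sq_nonneg _)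
    (Finset.mem_univ i)
  have h6 : ((w i).1 j) ^ 2 = 0 := le_antisymm (h5.trans h4) (sq_nonneg _)
  simpa using h6

end Penalty

/-! ### The empirical process over the restricted set -/

section EmpiricalProcess

variable {p n : ℕ} {𝒴 : Type*} [MeasurableSpace 𝒴] {P : Measure (Vec p × 𝒴)}
  [IsProbabilityMeasure P] {m : ℝ → 𝒴 → ℝ} {Θ : Set (Vec p)} {θ₀ : Vec p}

lemma measurable_lossAt (hm : Measurable (Function.uncurry m)) (θ : Vec p) :
    Measurable (lossAt m θ : Vec p × 𝒴 → ℝ) :=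
  hm.comp ((measurable_fst.inner measurable_const).prodMk measurable_snd)

omit [MeasurableSpace 𝒴] in
lemma continuous_lossAt (hconv : ∀ y, ConvexOn ℝ Set.univ fun t => m t y) (w : Vec p × 𝒴) :
    Continuous fun θ : Vec p => lossAt m θ w := by
  have h : Continuous fun t => m t w.2 :=
    continuousOn_univ.1 ((hconv w.2).continuousOn isOpen_univ)
  exact h.comp (continuous_const.inner continuous_id)

omit [IsProbabilityMeasure P] in
/-- The random Lipschitz constant of the loss may be taken measurable. -/
lemma LocalLossBehavior.exists_measurable {cL CL : ℝ} (h : LocalLossBehavior m P Θ θ₀ cL CL) :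
    ∃ ℓ : Vec p × 𝒴 → ℝ, Measurable ℓ ∧ (∀ w, 0 ≤ ℓ w) ∧
      (∀ᵐ w ∂P, ∀ t₁ t₂ : ℝ, |t₁| ≤ cL → |t₂| ≤ cL →
        |m (inner ℝ w.1 θ₀ + t₁) w.2 - m (inner ℝ w.1 θ₀ + t₂) w.2| ≤ ℓ w * |t₁ - t₂|) ∧
      Integrable (fun w => ℓ w ^ 8) P ∧ ∫ w, ℓ w ^ 8 ∂P ≤ (CL / 2) ^ 8 := by
  obtain ⟨⟨L, hL0, hlip, hint, hbound⟩, -⟩ := h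
  set g := hint.1.mk
  have hg : Measurable g := hint.1.stronglyMeasurable_mk.measurable
  have hsqrt : ∀ a : ℝ, 0 ≤ a → Real.sqrt (Real.sqrt (Real.sqrt (a ^ 8))) = a := by
    intro a ha
    rw [show a ^ 8 = (a ^ 4) ^ 2 by ring, Real.sqrt_sq (by positivity),
      show a ^ 4 = (a ^ 2) ^ 2 by ring, Real.sqrt_sq (by positivity), Real.sqrt_sq ha]
  have hae : (fun w => Real.sqrt (Real.sqrt (Real.sqrt (g w)))) =ᵐ[P] L := by
    filter_upwards [hint.1.ae_eq_mk] with w hw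
    rw [← hsqrt (L w) (hL0 w)]
    exact congrArg (fun a => Real.sqrt (Real.sqrt (Real.sqrt a))) hw.symm
  have hae8 : (fun w => Real.sqrt (Real.sqrt (Real.sqrt (g w))) ^ 8) =ᵐ[P] fun w => L w ^ 8 :=
    hae.fun_comp (· ^ 8)
  refine ⟨fun w => Real.sqrt (Real.sqrt (Real.sqrt (g w))), hg.sqrt.sqrt.sqrt,
    fun w => Real.sqrt_nonneg _, ?_, (integrable_congr hae8).2 hint,
    (integral_congr_ae hae8).trans_le hbound⟩
  filter_upwards [hlip, hae] with w h1 h2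
  rwa [h2]

/-- Chebyshev's inequality for the fourth powers of the Lipschitz constants, whose variance is
bounded by the eighth moment. -/
lemma measure_sum_pow_four_gt_le (hn : 0 < n) {ℓ : Vec p × 𝒴 → ℝ} (hℓ : Measurable ℓ) {CL : ℝ}
    (hCL : 0 < CL) (hint : Integrable (fun w => ℓ w ^ 8) P)
    (hbound : ∫ w, ℓ w ^ 8 ∂P ≤ (CL / 2) ^ 8) :
    Measure.pi (fun _ : Fin n => P) {w | n * CL ^ 4 < ∑ i, ℓ (w i) ^ 4} ≤
      ENNReal.ofReal (1 / (225 * n)) := by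
  have hn' : (0 : ℝ) < n := by exact_mod_cast hn
  have hpow : ∀ w, (ℓ w ^ 4) ^ 2 = ℓ w ^ 8 := fun w => by ring
  have hmem : MemLp (fun w => ℓ w ^ 4) 2 P := by
    refine (memLp_two_iff_integrable_sq (hℓ.pow_const 4).aestronglyMeasurable).2 ?_
    simpa only [hpow] using hint
  have hmean : ∫ w, ℓ w ^ 4 ∂P ≤ CL ^ 4 / 16 := by
    have h1 := variance_nonneg (fun w => ℓ w ^ 4) P
    rw [variance_eq_sub hmem] at h1
    simp only [Pi.pow_apply, hpow] at h1
    refine (abs_le_of_sq_le_sq' (b := CL ^ 4 / 16) ?_ (by positivity)).2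
    calc _ ≤ (CL / 2) ^ 8 := by linarith
      _ = _ := by ring
  have ht : 0 < n * (15 / 16 * CL ^ 4) := by positivity
  refine (measure_mono ?_).trans ((chebyshev_pi hmem ht).trans (ENNReal.ofReal_le_ofReal ?_))
  · intro w hw
    rw [Set.mem_ofPred_eq] at hw ⊢
    have := mul_le_mul_of_nonneg_left hmean hn'.le
    exact le_trans (by linarith) (le_abs_self _)
  · simp only [hpow]
    calc (n : ℝ) * (∫ w, ℓ w ^ 8 ∂P) / (n * (15 / 16 * CL ^ 4)) ^ 2
        ≤ (n : ℝ) * (CL / 2) ^ 8 / (n * (15 / 16 * CL ^ 4)) ^ 2 := by gcongr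
      _ = 1 / (225 * (n : ℝ)) := by field_simp; norm_num

variable {u Δ B CX cL CL y : ℝ}

/-- The deviation `∑ᵢ {m(Xᵢᵀ(θ₀ + δ), Yᵢ) - m(Xᵢᵀθ₀, Yᵢ)} - n (M(θ₀ + δ) - M(θ₀))` of the
empirical excess risk from its mean, scaled by the sample size. -/
def deviation (m : ℝ → 𝒴 → ℝ) (P : Measure (Vec p × 𝒴)) (θ₀ : Vec p) (w : Fin n → Vec p × 𝒴)
    (δ : Vec p) : ℝ :=
  ∑ i, (lossAt m (θ₀ + δ) (w i) - lossAt m θ₀ (w i)) - n * excessRisk m P θ₀ (θ₀ + δ)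

lemma measure_deviation_ge_le (hm : Measurable (Function.uncurry m))
    (hdiff : DiffAndIntegrable m P Θ) (hloss : LocalLossBehavior m P Θ θ₀ cL CL)
    (hθ₀ : θ₀ ∈ Θ) (hu : 0 ≤ u) (hucL : u ≤ cL) {δ : Vec p} (hδΘ : θ₀ + δ ∈ Θ) (hδ : ‖δ‖ ≤ u)
    (hy : 0 < y) (hvar : 4 * (n * CL ^ 2 * u ^ 2) ≤ y ^ 2) :
    Measure.pi (fun _ : Fin n => P) {w | y ≤ |deviation m P θ₀ w δ|} ≤ 1 / 4 := by
  set g : Vec p × 𝒴 → ℝ := fun w => lossAt m (θ₀ + δ) w - lossAt m θ₀ w with hg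
  have hgm : Measurable g := (measurable_lossAt hm _).sub (measurable_lossAt hm _)
  have h2 := hloss.2 u ⟨hu, hucL⟩ (θ₀ + δ) hδΘ (by rwa [add_sub_cancel_left])
  have hmem : MemLp g 2 P := (memLp_two_iff_integrable_sq hgm.aestronglyMeasurable).2 h2.1
  have hmean : ∫ w, g w ∂P = excessRisk m P θ₀ (θ₀ + δ) := by
    rw [hg, integral_sub (hdiff _ hδΘ).2 (hdiff _ hθ₀).2]; rfl
  have h := chebyshev_pi (n := n) hmem hy
  rw [hmean] at h
  refine h.trans ?_
  have hquarter : (1 / 4 : ENNReal) = ENNReal.ofReal (1 / 4) := by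
    rw [ENNReal.ofReal_div_of_pos (by norm_num)]; norm_num
  rw [hquarter]
  refine ENNReal.ofReal_le_ofReal ?_
  rw [div_le_iff₀ (by positivity)]
  have := mul_le_mul_of_nonneg_left h2.2 (Nat.cast_nonneg (α := ℝ) n)
  linarith

/-- Lipschitz loss, bounded regressors and bounded fourth moments in the sample: the conditions
under which the Rademacher process of the sample has a sub-Gaussian supremum. -/
def GoodSample (m : ℝ → 𝒴 → ℝ) (θ₀ : Vec p) (B CX cL CL : ℝ) (ℓ : Vec p × 𝒴 → ℝ)
    (w : Fin n → Vec p × 𝒴) : Prop :=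
  (∀ i j, |(w i).1 j| ≤ B) ∧ (∀ j, ∑ i, ((w i).1 j) ^ 4 ≤ (n : ℝ) * CX ^ 4) ∧
    ∑ i, ℓ (w i) ^ 4 ≤ n * CL ^ 4 ∧
    ∀ i, ∀ t₁ t₂ : ℝ, |t₁| ≤ cL → |t₂| ≤ cL →
      |m (inner ℝ (w i).1 θ₀ + t₁) (w i).2 - m (inner ℝ (w i).1 θ₀ + t₂) (w i).2| ≤
        ℓ (w i) * |t₁ - t₂|

omit [MeasurableSpace 𝒴] in
lemma GoodSample.card_signs_le {ℓ : Vec p × 𝒴 → ℝ} (hℓ : ∀ w, 0 ≤ ℓ w) {w : Fin n → Vec p × 𝒴}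
    (hw : GoodSample m θ₀ B CX cL CL ℓ w) (hn : 0 < n) (hp : 0 < p) (hB : 0 < B) (hCX : 0 < CX)
    (hCL : 0 < CL) (hcL : 0 < cL) (hΔ : 0 < Δ) (hΔB : B * Δ ≤ cL) {F : Finset (Vec p)}
    (hF : ∀ δ ∈ F, l1Norm δ ≤ Δ) (hy : 0 ≤ y) :
    ((Finset.univ.filter fun ε : Fin n → Bool => ∃ δ ∈ F,
      y < |∑ i, signVal (ε i) * (lossAt m (θ₀ + δ) (w i) - lossAt m θ₀ (w i))|).card : ℝ) ≤
      2 ^ n * (4 * p * Real.exp (-y ^ 2 / (2 * Δ ^ 2 * (n * CL ^ 2 * CX ^ 2)))) := by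
  obtain ⟨hX, hX4, hL4, hlip⟩ := hw
  have hn' : (0 : ℝ) < n := by exact_mod_cast hn
  have hinner : ∀ i, ∀ δ ∈ F, |(inner ℝ (w i).1 δ : ℝ)| ≤ cL := by
    intro i δ hδ
    rw [inner_eq_sum]
    calc |∑ j, (w i).1 j * δ j| ≤ ∑ j, B * |δ j| :=
          (Finset.abs_sum_le_sum_abs _ _).trans <| Finset.sum_le_sum fun j _ => by
            rw [abs_mul]; exact mul_le_mul_of_nonneg_right (hX i j) (abs_nonneg _)
      _ = B * l1Norm δ := by rw [l1Norm, Finset.mul_sum]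
      _ ≤ B * Δ := mul_le_mul_of_nonneg_left (hF δ hδ) hB.le
      _ ≤ cL := hΔB
  refine card_signs_two_sided (x := fun i => (w i).1) (ℓ := fun i => ℓ (w i))
    (f := fun i δ => lossAt m (θ₀ + δ) (w i) - lossAt m θ₀ (w i)) hp hΔ (by positivity)
    (fun i => hℓ _) ?_ ?_ hF ?_ hy
  · intro i s hs t ht
    have h := hlip i (inner ℝ (w i).1 s) (inner ℝ (w i).1 t) (hinner i s hs) (hinner i t ht)
    rw [sub_sub_sub_cancel_right, lossAt, lossAt, inner_add_right, inner_add_right]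
    exact h
  · intro i t ht
    have h := hlip i (inner ℝ (w i).1 t) 0 (hinner i t ht) (by simpa using hcL.le)
    rw [lossAt, lossAt, inner_add_right]
    simpa using h
  · intro j
    have hcs := Finset.sum_mul_sq_le_sq_mul_sq Finset.univ (fun i => ℓ (w i) ^ 2)
      fun i => (w i).1 j ^ 2
    simp only [← pow_mul, ← mul_pow] at hcs
    have h0 : 0 ≤ ∑ i, (w i).1 j ^ 4 := Finset.sum_nonneg fun i _ => by positivity
    have h1 : (∑ i, (ℓ (w i) * (w i).1 j) ^ 2) ^ 2 ≤ (n * CL ^ 2 * CX ^ 2) ^ 2 :=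
      hcs.trans ((mul_le_mul hL4 (hX4 j) h0 (by positivity)).trans (le_of_eq (by ring)))
    exact (abs_le_of_sq_le_sq' h1 (by positivity)).2

/-- Uniform tail bound for the empirical process over an arbitrary set of directions that are
small in both norms. -/
lemma measure_exists_deviation_gt_le (hn : 0 < n) (hp : 0 < p)
    (hm : Measurable (Function.uncurry m)) (hconv : ∀ y, ConvexOn ℝ Set.univ fun t => m t y)
    (hdiff : DiffAndIntegrable m P Θ) (hloss : LocalLossBehavior m P Θ θ₀ cL CL)
    (hθ₀ : θ₀ ∈ Θ) (hB : 0 < B) (hCX : 0 < CX) (hCL : 0 < CL) (hcL : 0 < cL) (hΔ : 0 < Δ)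
    (hΔB : B * Δ ≤ cL) (hu : 0 ≤ u) (hucL : u ≤ cL) (hy : 0 < y)
    (hvar : 4 * (n * CL ^ 2 * u ^ 2) ≤ y ^ 2) {ζ : ℝ} (hζ : 0 ≤ ζ)
    (hcov₁ : Measure.pi (fun _ : Fin n => P) {w | ∀ i j, |(w i).1 j| ≤ B}ᶜ ≤ ENNReal.ofReal ζ)
    (hcov₂ : Measure.pi (fun _ : Fin n => P) {w | ∀ j, ∑ i, ((w i).1 j) ^ 4 ≤ (n : ℝ) * CX ^ 4}ᶜ ≤
      ENNReal.ofReal ζ)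
    {D : Set (Vec p)} (hDΘ : ∀ δ ∈ D, θ₀ + δ ∈ Θ) (hDu : ∀ δ ∈ D, ‖δ‖ ≤ u)
    (hDΔ : ∀ δ ∈ D, l1Norm δ ≤ Δ) :
    Measure.pi (fun _ : Fin n => P) {w | ∃ δ ∈ D, 2 * y < |deviation m P θ₀ w δ|} ≤
      ENNReal.ofReal (8 / 3 * (2 * ζ + 1 / (225 * n) +
        4 * p * Real.exp (-(y / 2) ^ 2 / (2 * Δ ^ 2 * (n * CL ^ 2 * CX ^ 2))))) := by
  set ν := Measure.pi (fun _ : Fin n => P)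
  obtain ⟨ρ, hρdef⟩ : ∃ ρ, ρ = 4 * p * Real.exp (-(y / 2) ^ 2 /
    (2 * Δ ^ 2 * (n * CL ^ 2 * CX ^ 2))) := ⟨_, rfl⟩
  have hρ : 0 ≤ ρ := by rw [hρdef]; positivity
  rw [← hρdef]
  obtain ⟨ℓ, hℓm, hℓ0, hlip, hℓint, hℓbound⟩ := hloss.exists_measurable
  set bad := toMeasurable ν {w | GoodSample m θ₀ B CX cL CL ℓ w}ᶜ with hbaddef
  have hbad : ν bad ≤ ENNReal.ofReal (2 * ζ + 1 / (225 * n)) := by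
    rw [hbaddef, measure_toMeasurable]
    have hnull : ν {w | ∀ i, ∀ t₁ t₂ : ℝ, |t₁| ≤ cL → |t₂| ≤ cL →
      |m (inner ℝ (w i).1 θ₀ + t₁) (w i).2 - m (inner ℝ (w i).1 θ₀ + t₂) (w i).2| ≤
        ℓ (w i) * |t₁ - t₂|}ᶜ = 0 :=
      ae_all_iff.2 fun i =>
        (measurePreserving_eval (fun _ : Fin n => P) i).quasiMeasurePreserving.ae hlip
    have hsub : {w : Fin n → Vec p × 𝒴 | GoodSample m θ₀ B CX cL CL ℓ w}ᶜ ⊆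
        (({w | ∀ i j, |(w i).1 j| ≤ B}ᶜ ∪ {w | ∀ j, ∑ i, ((w i).1 j) ^ 4 ≤ (n : ℝ) * CX ^ 4}ᶜ) ∪
          {w | n * CL ^ 4 < ∑ i, ℓ (w i) ^ 4}) ∪
        {w | ∀ i, ∀ t₁ t₂ : ℝ, |t₁| ≤ cL → |t₂| ≤ cL →
          |m (inner ℝ (w i).1 θ₀ + t₁) (w i).2 - m (inner ℝ (w i).1 θ₀ + t₂) (w i).2| ≤
            ℓ (w i) * |t₁ - t₂|}ᶜ := by
      intro w hw
      simp only [Set.mem_compl_iff, Set.mem_union, Set.mem_ofPred_eq] at hw ⊢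
      by_contra hcon
      simp only [not_or, not_not, not_lt] at hcon
      exact hw ⟨hcon.1.1.1, hcon.1.1.2, hcon.1.2, hcon.2⟩
    refine (measure_mono hsub).trans ((measure_union_le _ _).trans ?_)
    rw [hnull, add_zero, two_mul, ENNReal.ofReal_add (by positivity) (by positivity),
      ENNReal.ofReal_add hζ hζ]
    refine (measure_union_le _ _).trans (add_le_add ((measure_union_le _ _).trans
      (add_le_add hcov₁ hcov₂)) (measure_sum_pow_four_gt_le hn hℓm hCL hℓint hℓbound))
  have hfin : ∀ F : Finset (Vec p), ↑F ⊆ D →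
      ν (⋃ δ ∈ F, {w | 2 * y < |deviation m P θ₀ w δ|}) ≤
        ENNReal.ofReal (8 / 3 * (2 * ζ + 1 / (225 * n) + ρ)) := by
    intro F hFD
    have hset : ⋃ δ ∈ F, {w : Fin n → Vec p × 𝒴 | 2 * y < |deviation m P θ₀ w δ|} =
        {w | ∃ δ ∈ F, 2 * y < |deviation m P θ₀ w δ|} := by ext; simp
    have hsymm := symmetrization (P := P) (n := n) (F := F)
      (f := fun δ w => lossAt m (θ₀ + δ) w - lossAt m θ₀ w)
      (e := fun δ => excessRisk m P θ₀ (θ₀ + δ))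
      (fun δ _ => (measurable_lossAt hm _).sub (measurable_lossAt hm _))
      (y := y) (fun δ hδ => measure_deviation_ge_le hm hdiff hloss hθ₀ hu hucL
        (hDΘ δ (hFD hδ)) (hDu δ (hFD hδ)) hy hvar)
      (bad := bad) (measurableSet_toMeasurable _ _) (ρ := ENNReal.ofReal ρ) (by
        intro w hw
        have hgood : GoodSample m θ₀ B CX cL CL ℓ w := by
          by_contra h
          exact hw (subset_toMeasurable _ _ h)
        have h := hgood.card_signs_le hℓ0 hn hp hB hCX hCL hcL hΔ hΔB
          (fun δ hδ => hDΔ δ (hFD hδ)) (half_pos hy).le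
        rw [← hρdef] at h
        have h2 : (2 : ENNReal) ^ n * ENNReal.ofReal ρ = ENNReal.ofReal (2 ^ n * ρ) := by
          rw [ENNReal.ofReal_mul (by positivity), ENNReal.ofReal_pow (by norm_num)]
          norm_num
        rw [h2, ← ENNReal.ofReal_natCast]
        exact ENNReal.ofReal_le_ofReal h)
    rw [hset]
    change 3 / 4 * ν {w | ∃ δ ∈ F, 2 * y < |deviation m P θ₀ w δ|} ≤ _ at hsymm
    set x := ν {w | ∃ δ ∈ F, 2 * y < |deviation m P θ₀ w δ|}
    have hx : x ≠ ⊤ := measure_ne_top _ _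
    have h1 : 3 / 4 * x ≤ ENNReal.ofReal (2 * (2 * ζ + 1 / (225 * n) + ρ)) := by
      refine hsymm.trans ?_
      rw [ENNReal.ofReal_mul (by norm_num), ENNReal.ofReal_add (by positivity) hρ]
      norm_num
      gcongr
      refine hbad.trans (le_of_eq ?_)
      norm_num
    rw [ENNReal.le_ofReal_iff_toReal_le (ENNReal.mul_ne_top (by finiteness) hx) (by positivity),
      ENNReal.toReal_mul, ENNReal.toReal_div] at h1
    rw [ENNReal.le_ofReal_iff_toReal_le hx (by positivity)]
    norm_num at h1 ⊢
    linarith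
  -- Approximating the pairs `(δ, M(θ₀ + δ) - M(θ₀))` by countably many of them
  -- avoids any appeal to the continuity of `M`.
  set Φ : Vec p → Vec p × ℝ := fun δ => (δ, excessRisk m P θ₀ (θ₀ + δ))
  obtain ⟨c, hcsub, hccount, hcdense⟩ :=
    (TopologicalSpace.IsSeparable.of_separableSpace (Φ '' D)).exists_countable_dense_subset
  have hcD : Prod.fst '' c ⊆ D := by
    rintro _ ⟨z, hz, rfl⟩
    obtain ⟨δ, hδ, rfl⟩ := hcsub hz
    exact hδ
  refine (measure_mono ?_).trans (measure_biUnion_le_of_finset (hccount.image Prod.fst)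
    (fun δ => {w | 2 * y < |deviation m P θ₀ w δ|}) fun F hF => hfin F (hF.trans hcD))
  rintro w ⟨δ, hδ, hwδ⟩
  have hopen : IsOpen {z : Vec p × ℝ | 2 * y <
      |∑ i, (lossAt m (θ₀ + z.1) (w i) - lossAt m θ₀ (w i)) - n * z.2|} := by
    refine isOpen_lt continuous_const ((continuous_finsetSum _ fun i _ => ?_).sub
      (continuous_const.mul continuous_snd)).abs
    exact ((continuous_lossAt hconv (w i)).comp (continuous_const.add continuous_fst)).sub
      continuous_const
  obtain ⟨z, hz, hzc⟩ := mem_closure_iff.1 (hcdense ⟨δ, hδ, rfl⟩) _ hopen hwδ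
  obtain ⟨δ', hδ', rfl⟩ := hcsub hzc
  exact Set.mem_biUnion (Set.mem_image_of_mem _ hzc) hz

end EmpiricalProcess

/-! ### The estimation error -/

section Estimate

variable {p n : ℕ} {𝒴 : Type*}

/-- The deterministic core of the error bound: on a sample whose penalty dominates the score and
whose empirical process is small on the sphere of radius `u` in the restricted set, no solution has
an error longer than `u`. -/
lemma norm_sub_le_of_sample [MeasurableSpace 𝒴] {P : Measure (Vec p × 𝒴)} {m : ℝ → 𝒴 → ℝ}
    {Θ : Set (Vec p)} {θ₀ θ : Vec p} {w : Fin n → Vec p × 𝒴} {c₀ cM u e lam lamBar : ℝ}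
    (hn : 0 < n) (hconv : ∀ y, ConvexOn ℝ Set.univ fun t => m t y) (hΘ : Convex ℝ Θ)
    (hθ₀ : θ₀ ∈ Θ) (hc₀ : 1 < c₀) (hu : 0 < u) (hlam0 : 0 ≤ lam)
    (hdiff : ∀ i, DifferentiableAt ℝ (fun t => m t (w i).2) (inner ℝ (w i).1 θ₀))
    (hscore : ∀ j, c₀ * |(1 / (n : ℝ)) * ∑ i, (w i).1 j * residual m θ₀ (w i)| ≤ lam)
    (hlamBar : lam ≤ lamBar)
    (hdegenerate : 0 < lam ∨
      (∀ i, (w i).1 = 0) ∧ ∃ δ ∈ restrictedSet Θ θ₀ (cBar c₀), ‖δ‖ = u)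
    (hmargin : ∀ δ ∈ restrictedSet Θ θ₀ (cBar c₀), ‖δ‖ = u →
      cM * u ^ 2 ≤ excessRisk m P θ₀ (θ₀ + δ))
    (hdev : ∀ δ ∈ restrictedSet Θ θ₀ (cBar c₀), ‖δ‖ = u →
      |deviation m P θ₀ w δ| ≤ n * e * u)
    (hradius : e + lamBar * Real.sqrt (sparsity θ₀) < cM * u)
    (hθ : θ ∈ penalizedSolutions m Θ w lam) :
    θ - θ₀ ∈ restrictedSet Θ θ₀ (cBar c₀) ∧ ‖θ - θ₀‖ ≤ u := by
  have hn' : (0 : ℝ) < n := by exact_mod_cast hn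
  have hcontra : ∀ δ ∈ restrictedSet Θ θ₀ (cBar c₀), ‖δ‖ = u →
      lam * (Real.sqrt (sparsity θ₀) * u) <
        empiricalRisk m w (θ₀ + δ) - empiricalRisk m w θ₀ := by
    intro δ hδ hδu
    have hrw : deviation m P θ₀ w δ = n * ((empiricalRisk m w (θ₀ + δ) - empiricalRisk m w θ₀) -
        excessRisk m P θ₀ (θ₀ + δ)) := by
      rw [deviation, Finset.sum_sub_distrib, empiricalRisk, empiricalRisk]
      field_simp
    have h1 := (abs_le.1 (hdev δ hδ hδu)).1
    rw [hrw, mul_assoc, ← mul_neg] at h1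
    have h2 := le_of_mul_le_mul_left h1 hn'
    have h3 := hmargin δ hδ hδu
    have h4 := mul_lt_mul_of_pos_right hradius hu
    have h5 : lam * (Real.sqrt (sparsity θ₀) * u) ≤ lamBar * (Real.sqrt (sparsity θ₀) * u) :=
      mul_le_mul_of_nonneg_right hlamBar (by positivity)
    nlinarith
  rcases hdegenerate with hlam | ⟨hX, δ, hδ, hδu⟩
  · have hmem := sub_mem_restrictedSet hconv hdiff hc₀ hlam hscore hθ₀ hθ
    refine ⟨hmem, not_lt.1 fun hlt => ?_⟩
    obtain ⟨δ, hδ, hδu, hle⟩ := exists_mem_sphere_of_lt_norm hconv hΘ hlam0 hu hθ₀ hθ hmem hlt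
    exact absurd hle (not_le.2 (hcontra δ hδ hδu))
  · -- without variation in the regressors the empirical risk is constant
    have h := hcontra δ hδ hδu
    have hzero : empiricalRisk m w (θ₀ + δ) - empiricalRisk m w θ₀ = 0 := by
      simp [empiricalRisk, lossAt, hX]
    rw [hzero] at h
    exact absurd h (not_lt.2 (by positivity))

lemma CEps_sq {c₀ CL CX : ℝ} :
    CEps c₀ CL CX ^ 2 = 512 * (1 + cBar c₀) ^ 2 * CL ^ 2 * CX ^ 2 := by
  rw [CEps, mul_pow, mul_pow, mul_pow, mul_pow, Real.sq_sqrt (by norm_num)]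
  ring

lemma four_mul_exp_log_le (hn : 3 ≤ n) (hp : 2 ≤ p) :
    4 * (p : ℝ) * Real.exp (-(16 * Real.log (p * n))) ≤ 1 / n := by
  have hn' : (3 : ℝ) ≤ n := by exact_mod_cast hn
  have hp' : (2 : ℝ) ≤ p := by exact_mod_cast hp
  have hq : (6 : ℝ) ≤ p * n := by nlinarith
  set q : ℝ := p * n with hqdef
  have hexp : Real.exp (-(16 * Real.log q)) = (q ^ 16)⁻¹ := by
    rw [Real.exp_neg, ← Nat.cast_ofNat (n := 16), Real.exp_nat_mul,
      Real.exp_log (by linarith)]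
  have h4 : 4 * q ≤ q ^ 16 := by
    have h1 : (1 : ℝ) ≤ q ^ 14 := one_le_pow₀ (by linarith)
    nlinarith [mul_le_mul_of_nonneg_left h1 (sq_nonneg q)]
  rw [hexp, ← div_eq_mul_inv, div_le_div_iff₀ (by positivity) (by linarith)]
  linarith

lemma cBar_pos {c₀ : ℝ} (hc₀ : 1 < c₀) : 0 < cBar c₀ :=
  div_pos (by linarith) (by linarith)

/-- The choice of `C_ε` makes the exponent of the empirical process bound equal to `-16 ln(pn)`. -/
lemma exponent_eq {s c u e CL CX l y : ℝ} (hn : 0 < n) (hs : 0 < s) (hc : 0 < 1 + c) (hu : 0 < u)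
    (hCL : 0 < CL) (hCX : 0 < CX)
    (he : e ^ 2 * n = 512 * (1 + c) ^ 2 * CL ^ 2 * CX ^ 2 * (s * l)) (hy : y = n * e * u / 2) :
    -(y / 2) ^ 2 / (2 * ((1 + c) * Real.sqrt s * u) ^ 2 * (n * CL ^ 2 * CX ^ 2)) = -(16 * l) := by
  have hn' : (0 : ℝ) < n := by exact_mod_cast hn
  have h1 : (y / 2) ^ 2 =
      n * u ^ 2 * (512 * (1 + c) ^ 2 * CL ^ 2 * CX ^ 2 * (s * l)) / 16 := by
    rw [← he, hy]; ring
  rw [h1, mul_pow, mul_pow, Real.sq_sqrt hs.le, div_eq_iff (by positivity)]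
  ring

variable [MeasurableSpace 𝒴] {P : Measure (Vec p × 𝒴)} [IsProbabilityMeasure P] {m : ℝ → 𝒴 → ℝ}
  {Θ : Set (Vec p)} {θ₀ : Vec p} {α d : ℝ}

lemma ae_pi_forall {q : Vec p × 𝒴 → Prop} (h : ∀ᵐ w ∂P, q w) :
    ∀ᵐ w ∂Measure.pi fun _ : Fin n => P, ∀ i, q (w i) :=
  ae_all_iff.2 fun i =>
    (measurePreserving_eval (fun _ : Fin n => P) i).quasiMeasurePreserving.ae h

lemma measure_score_residual_le (hp : 0 < p) (hmean : ResidualCondMeanZero m P θ₀)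
    (hres : ResidualInterval m P θ₀ d) (hd : 0 < d) (hα : α ∈ Set.Ioo (0 : ℝ) 1) :
    Measure.pi (fun _ : Fin n => P) {w | ∃ j, d * Real.sqrt (Real.log (2 * p / α) / 2 *
        ∑ i, (w i).1 j ^ 2) < |∑ i, (w i).1 j * residual m θ₀ (w i)|} ≤ ENNReal.ofReal α := by
  obtain ⟨rlo, rhi, hlo, hhi, hmem⟩ := hres
  obtain ⟨hint, hcond⟩ := hmean
  -- the residual is only almost everywhere equal to a measurable function
  obtain ⟨r, hr, hae⟩ := hint.1.aemeasurable
  have h := measure_score_le (n := n) hp hr (hint.congr hae)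
    ((condExp_congr_ae hae.symm).trans hcond) hlo hhi hd (by
      filter_upwards [hmem, hae] with w h1 h2
      rwa [← h2]) hα
  refine (measure_mono_ae ?_).trans h
  filter_upwards [ae_pi_forall (n := n) hae] with w hw hex
  change ∃ j, _ < |∑ i, (w i).1 j * r (w i)|
  simp only [← hw]
  exact hex

/-- The probability that some solution violates the error bound `u`. The parameter `e` is the
level of the empirical process per unit of `ℓ²` radius. -/
lemma measure_not_estimate_le {c₀ cM cM' ζ B CX cL CL u e lamBar : ℝ} (hn : 3 ≤ n) (hp : 2 ≤ p)
    (hm : Measurable (Function.uncurry m)) (hs : 1 ≤ sparsity θ₀)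
    (hc₀ : 1 < c₀) (hα : α ∈ Set.Ioo (0 : ℝ) 1) (hζ : 0 < ζ) (hB : 1 ≤ B) (hCX : 0 < CX)
    (hcL : 0 < cL) (hCL : 0 < CL) (hd : 0 < d)
    (hΘconv : Convex ℝ Θ) (hθ₀ : θ₀ ∈ Θ) (hconv : ∀ y, ConvexOn ℝ Set.univ fun t => m t y)
    (hdiff : DiffAndIntegrable m P Θ) (hmargin : Margin m P Θ θ₀ cM cM')
    (hcov₁ : Measure.pi (fun _ : Fin n => P) {w | ∀ i j, |(w i).1 j| ≤ B}ᶜ ≤ ENNReal.ofReal ζ)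
    (hcov₂ : Measure.pi (fun _ : Fin n => P) {w | ∀ j, ∑ i, ((w i).1 j) ^ 4 ≤ (n : ℝ) * CX ^ 4}ᶜ ≤
      ENNReal.ofReal ζ)
    (hloss : LocalLossBehavior m P Θ θ₀ cL CL) (hmean : ResidualCondMeanZero m P θ₀)
    (hres : ResidualInterval m P θ₀ d)
    (hnondeg : (∀ᵐ w ∂P, w.1 ≠ 0) ∨ ∃ δ ∈ restrictedSet Θ θ₀ (cBar c₀), ‖δ‖ = u)
    (hu : 0 < u) (he : 0 < e)
    (hesq : e ^ 2 * n = CEps c₀ CL CX ^ 2 * (sparsity θ₀ * Real.log (p * n)))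
    (hside₁ : 16 * CL ^ 2 ≤ CEps c₀ CL CX ^ 2 * (sparsity θ₀ * Real.log (p * n)))
    (hlamBar : lamBar = CLam c₀ CX d * Real.sqrt (Real.log (p / α) / n))
    (hradius : e + lamBar * Real.sqrt (sparsity θ₀) < cM * u)
    (hside₂ : (1 + cBar c₀) * Real.sqrt (sparsity θ₀) * u ≤ min (cL / B) cM') :
    Measure.pi (fun _ : Fin n => P) {w |
      ∀ θ ∈ penalizedSolutions m Θ w (analyticPenalty c₀ d α w),
        θ - θ₀ ∈ restrictedSet Θ θ₀ (cBar c₀) ∧ ‖θ - θ₀‖ ≤ u}ᶜ ≤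
      ENNReal.ofReal (α + 5 / n + 9 * ζ) := by
  have hn0 : 0 < n := by omega
  have hn' : (0 : ℝ) < n := by exact_mod_cast hn0
  have hpR : (2 : ℝ) ≤ p := by exact_mod_cast hp
  have hα0 := hα.1
  have hsR : (1 : ℝ) ≤ sparsity θ₀ := by exact_mod_cast hs
  have hc := cBar_pos hc₀
  have hS1 : 1 ≤ Real.sqrt (sparsity θ₀) := Real.one_le_sqrt.2 hsR
  have hlog2α : 0 < Real.log (2 * p / α) := Real.log_pos (by
    rw [lt_div_iff₀ hα0]; linarith [hα.2])
  -- the radius in `ℓ¹` norm of the sphere of radius `u` in the restricted set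
  obtain ⟨Δ, hΔ⟩ : ∃ Δ, Δ = (1 + cBar c₀) * Real.sqrt (sparsity θ₀) * u := ⟨_, rfl⟩
  rw [← hΔ] at hside₂
  have hΔpos : 0 < Δ := by rw [hΔ]; positivity
  have hΔB : B * Δ ≤ cL := by
    have h := hside₂.trans (min_le_left _ _)
    rw [le_div_iff₀ (by linarith)] at h
    linarith
  have hΔM : Δ ≤ cM' := hside₂.trans (min_le_right _ _)
  have hucL : u ≤ cL := by
    have h1 : 1 ≤ (1 + cBar c₀) * Real.sqrt (sparsity θ₀) := by nlinarith
    have h2 : u ≤ Δ := by rw [hΔ]; nlinarith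
    nlinarith
  obtain ⟨y, hy⟩ : ∃ y, y = n * e * u / 2 := ⟨_, rfl⟩
  have hypos : 0 < y := by rw [hy]; positivity
  have hvar : 4 * (n * CL ^ 2 * u ^ 2) ≤ y ^ 2 := by
    have h1 : y ^ 2 = n * u ^ 2 * (e ^ 2 * n) / 4 := by rw [hy]; ring
    have h2 := mul_le_mul_of_nonneg_left hside₁ (show 0 ≤ n * u ^ 2 by positivity)
    rw [h1, hesq]
    linarith
  have hsphere : ∀ δ ∈ restrictedSet Θ θ₀ (cBar c₀), ‖δ‖ = u → l1Norm δ ≤ Δ := by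
    intro δ hδ hδu
    have h := l1Norm_le_of_mem_restrictedSet hc.le hδ
    rwa [hδu, ← hΔ] at h
  have hdevbound := measure_exists_deviation_gt_le hn0 (by omega) hm hconv hdiff hloss
    hθ₀ (by linarith) hCX hCL hcL hΔpos hΔB hu.le hucL hypos hvar hζ.le hcov₁ hcov₂
    (D := {δ | δ ∈ restrictedSet Θ θ₀ (cBar c₀) ∧ ‖δ‖ = u})
    (fun δ hδ => hδ.1.2) (fun δ hδ => hδ.2.le) (fun δ hδ => hsphere δ hδ.1 hδ.2)
  rw [CEps_sq] at hesq
  rw [hΔ, exponent_eq hn0 (by linarith) (by linarith) hu hCL hCX hesq hy] at hdevbound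
  have hscore := measure_score_residual_le (n := n) (by omega) hmean hres hd hα
  have hnull₁ := ae_pi_forall (n := n) (hdiff θ₀ hθ₀).1
  have hnull₂ : ∀ᵐ w ∂Measure.pi fun _ : Fin n => P,
      ∀ i, (∀ᵐ z ∂P, z.1 ≠ 0) → (w i).1 ≠ 0 := by
    by_cases hX : ∀ᵐ z ∂P, z.1 ≠ 0
    · filter_upwards [ae_pi_forall (n := n) hX] with w hw i _ using hw i
    · exact .of_forall fun w i h => absurd h hX
  have hsub : ∀ᵐ w ∂Measure.pi fun _ : Fin n => P,
      w ∈ {w | ∀ θ ∈ penalizedSolutions m Θ w (analyticPenalty c₀ d α w),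
        θ - θ₀ ∈ restrictedSet Θ θ₀ (cBar c₀) ∧ ‖θ - θ₀‖ ≤ u}ᶜ →
      w ∈ ({w | ∃ δ ∈ {δ | δ ∈ restrictedSet Θ θ₀ (cBar c₀) ∧ ‖δ‖ = u},
          2 * y < |deviation m P θ₀ w δ|} ∪
        {w | ∃ j, d * Real.sqrt (Real.log (2 * p / α) / 2 *
          ∑ i, (w i).1 j ^ 2) < |∑ i, (w i).1 j * residual m θ₀ (w i)|}) ∪
        {w | ∀ j, ∑ i, ((w i).1 j) ^ 4 ≤ (n : ℝ) * CX ^ 4}ᶜ := by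
    filter_upwards [hnull₁, hnull₂] with w hw₁ hw₂ hw
    by_contra hcon
    refine hw fun θ hθ => ?_
    simp only [Set.mem_union, Set.mem_compl_iff, Set.mem_ofPred_eq, not_or, not_not, not_exists,
      not_and, not_lt] at hcon
    obtain ⟨⟨hdev, hsc⟩, hX4⟩ := hcon
    have hpen0 : 0 ≤ analyticPenalty c₀ d α w := analyticPenalty_nonneg (by linarith) hd.le
    refine norm_sub_le_of_sample (P := P) (e := e) (cM := cM) (lamBar := lamBar)
      hn0 hconv hΘconv hθ₀ hc₀ hu hpen0 hw₁
      (fun j => score_le_analyticPenalty hn0 (by linarith) hd.le hlog2α.le (hsc j))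
      (hlamBar ▸ analyticPenalty_le hn0 hp (by linarith) hd.le hα hCX.le hX4) ?_
      (fun δ hδ hδu => ?_) (fun δ hδ hδu => ?_) hradius hθ
    · rcases hpen0.lt_or_eq with h | h
      · exact Or.inl h
      · have hX := eq_zero_of_analyticPenalty_le_zero hn0 (by linarith) hd hlog2α h.ge
        refine Or.inr ⟨hX, ?_⟩
        rcases hnondeg with hne | hex
        · exact absurd (hX ⟨0, hn0⟩) (hw₂ ⟨0, hn0⟩ hne)
        · exact hex
    · have := hmargin (θ₀ + δ) hδ.2
        (by rw [add_sub_cancel_left]; exact (hsphere δ hδ hδu).trans hΔM)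
      rwa [add_sub_cancel_left, hδu] at this
    · have := hdev δ ⟨hδ, hδu⟩
      rw [hy] at this
      linarith
  refine (measure_mono_ae hsub).trans ?_
  refine (measure_union_le _ _).trans ((add_le_add ((measure_union_le _ _).trans
    (add_le_add hdevbound hscore)) hcov₂).trans ?_)
  rw [← ENNReal.ofReal_add (by positivity) hα0.le, ← ENNReal.ofReal_add (by positivity) hζ.le]
  refine ENNReal.ofReal_le_ofReal ?_
  have h1 := four_mul_exp_log_le hn hp
  have h2 : 1 / (225 * (n : ℝ)) = 1 / 225 * (1 / n) := by field_simp
  have h3 : 5 / (n : ℝ) = 5 * (1 / n) := by ring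
  have h4 : 0 < 1 / (n : ℝ) := by positivity
  rw [h2, h3]
  linarith

lemma measure_compl_le_of_map {Ω : Type*} [MeasurableSpace Ω] {μ : Measure Ω} {S : Type*}
    [MeasurableSpace S] {ν : Measure S} [IsProbabilityMeasure ν] {V : Ω → S} (hV : Measurable V)
    (hlaw : μ.map V = ν) {ζ : ℝ} (hζ : 0 ≤ ζ) {G : Set S} (hG : MeasurableSet G)
    (h : 1 - ζ ≤ μ.real (V ⁻¹' G)) : ν Gᶜ ≤ ENNReal.ofReal ζ := by
  rw [← map_measureReal_apply hV hG, hlaw] at h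
  rw [ENNReal.le_ofReal_iff_toReal_le (measure_ne_top _ _) hζ]
  change ν.real Gᶜ ≤ ζ
  rw [probReal_compl_eq_one_sub hG]
  linarith

/-- The failure event need not be measurable; its measurable hull is excluded instead. -/
lemma exists_measurableSet_of_map {Ω : Type*} [MeasurableSpace Ω] {μ : Measure Ω} {S : Type*}
    [MeasurableSpace S] {ν : Measure S} [IsProbabilityMeasure ν] {V : Ω → S} (hV : Measurable V)
    (hlaw : μ.map V = ν) {η : ℝ} (hη : 0 ≤ η) {G : Set S} (h : ν Gᶜ ≤ ENNReal.ofReal η) :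
    ∃ A, MeasurableSet A ∧ 1 - η ≤ μ.real A ∧ ∀ ω ∈ A, V ω ∈ G := by
  have hmeas := (measurableSet_toMeasurable ν Gᶜ).compl
  refine ⟨V ⁻¹' (toMeasurable ν Gᶜ)ᶜ, hV hmeas, ?_, fun ω hω => ?_⟩
  · rw [← map_measureReal_apply hV hmeas, hlaw,
      probReal_compl_eq_one_sub (measurableSet_toMeasurable _ _), Measure.real,
      measure_toMeasurable]
    have := (ENNReal.le_ofReal_iff_toReal_le (measure_ne_top _ _) hη).1 h
    linarith
  · by_contra hG
    exact hω (subset_toMeasurable _ _ hG)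

end Estimate

end PenalizedM

end

theorem theorem2
    {n p : ℕ} (hn : 3 ≤ n) (hp : 2 ≤ p)
    {𝒴 : Type*} [MeasurableSpace 𝒴]
    {Ω : Type*} [MeasurableSpace Ω] (μ : MeasureTheory.Measure Ω)
    [MeasureTheory.IsProbabilityMeasure μ]
    -- the distribution of `(X, Y)` and `n` independent copies of it
    (P : MeasureTheory.Measure (PenalizedM.Vec p × 𝒴)) [MeasureTheory.IsProbabilityMeasure P]
    (W : Fin n → Ω → PenalizedM.Vec p × 𝒴)
    (hWmeas : ∀ i, Measurable (W i))
    (hWindep : ProbabilityTheory.iIndepFun W μ)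
    (hWlaw : ∀ i, μ.map (W i) = P)
    -- the loss, the parameter space and the estimand
    (m : ℝ → 𝒴 → ℝ) (hm : Measurable (Function.uncurry m))
    (Θ : Set (PenalizedM.Vec p)) (θ₀ : PenalizedM.Vec p)
    (hθ₀ : IsMinOn (PenalizedM.risk m P) Θ θ₀)
    (hs : 1 ≤ PenalizedM.sparsity θ₀)
    -- constants
    (c₀ α cM cM' ζ B CX cL CL d : ℝ)
    (hc₀ : 1 < c₀) (hα : α ∈ Set.Ioo (0 : ℝ) 1) (hcM : 0 < cM) (hcM' : 0 < cM')
    (hζ : 0 < ζ) (hB : 1 ≤ B) (hCX : 0 < CX) (hcL : 0 < cL) (hCL : 0 < CL) (hd : 0 < d)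
    -- assumptions
    (hΘconv : Convex ℝ Θ) (hΘint : θ₀ ∈ interior Θ)
    (hconv : ∀ y, ConvexOn ℝ Set.univ (fun t => m t y))
    (hdiff : PenalizedM.DiffAndIntegrable m P Θ)
    (hmargin : PenalizedM.Margin m P Θ θ₀ cM cM')
    (hcov : PenalizedM.CovariateBounds μ W ζ B CX)
    (hloss : PenalizedM.LocalLossBehavior m P Θ θ₀ cL CL)
    (hmean : PenalizedM.ResidualCondMeanZero m P θ₀)
    (hres : PenalizedM.ResidualInterval m P θ₀ d)
    -- side conditions
    (hside₁ : 16 * CL ^ 2 / PenalizedM.CEps c₀ CL CX ^ 2 ≤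
      PenalizedM.sparsity θ₀ * Real.log (p * n))
    (hside₂ : (1 + PenalizedM.cBar c₀) *
        PenalizedM.uZero n p (PenalizedM.sparsity θ₀) c₀ cM CL CX d α *
        Real.sqrt (PenalizedM.sparsity θ₀) ≤ min (cL / B) cM')
    -- nondegeneracy: the penalty level is almost surely positive, or `Θ` is not too small
    (hnondeg : (∀ᵐ w ∂P, w.1 ≠ 0) ∨
      ∃ δ ∈ PenalizedM.restrictedSet Θ θ₀ (PenalizedM.cBar c₀),
        ‖δ‖ = PenalizedM.uZero n p (PenalizedM.sparsity θ₀) c₀ cM CL CX d α) :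
    ∃ A : Set Ω, MeasurableSet A ∧ 1 - α - 5 / (n : ℝ) - 9 * ζ ≤ μ.real A ∧
      ∀ ω ∈ A, ∀ θ ∈ PenalizedM.penalizedSolutions m Θ (fun i => W i ω)
          (PenalizedM.analyticPenalty c₀ d α (fun i => W i ω)),
        ‖θ - θ₀‖ ≤ 2 / cM *
          (PenalizedM.CEps c₀ CL CX *
              Real.sqrt (PenalizedM.sparsity θ₀ * Real.log (p * n) / n) +
            (1 + PenalizedM.cBar c₀) * PenalizedM.CLam c₀ CX d *
              Real.sqrt (PenalizedM.sparsity θ₀ * Real.log (p / α) / n)) ∧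
        PenalizedM.l1Norm (θ - θ₀) ≤ 2 * (1 + PenalizedM.cBar c₀) / cM *
          (PenalizedM.CEps c₀ CL CX *
              Real.sqrt ((PenalizedM.sparsity θ₀ : ℝ) ^ 2 * Real.log (p * n) / n) +
            (1 + PenalizedM.cBar c₀) * PenalizedM.CLam c₀ CX d *
              Real.sqrt ((PenalizedM.sparsity θ₀ : ℝ) ^ 2 * Real.log (p / α) / n)) := by
  have hn' : (0 : ℝ) < n := by exact_mod_cast (by omega : 0 < n)
  have hnR : (3 : ℝ) ≤ n := by exact_mod_cast hn
  have hpR : (2 : ℝ) ≤ p := by exact_mod_cast hp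
  have hα0 := hα.1
  have hc₀' : 0 < c₀ := by linarith
  have hc := PenalizedM.cBar_pos hc₀
  have hsR : (1 : ℝ) ≤ PenalizedM.sparsity θ₀ := by exact_mod_cast hs
  have hS1 : 1 ≤ Real.sqrt (PenalizedM.sparsity θ₀) := Real.one_le_sqrt.2 hsR
  have hlog : 0 < Real.log (p * n) := Real.log_pos (by nlinarith)
  have hlogα : 0 < Real.log (p / α) := Real.log_pos (by
    rw [lt_div_iff₀ hα0]; linarith [hα.2])
  have hCεpos : 0 < PenalizedM.CEps c₀ CL CX := by rw [PenalizedM.CEps]; positivity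
  have hClpos : 0 < PenalizedM.CLam c₀ CX d := by rw [PenalizedM.CLam]; positivity
  obtain ⟨e, he⟩ : ∃ e, e = PenalizedM.CEps c₀ CL CX *
    Real.sqrt (PenalizedM.sparsity θ₀ * Real.log (p * n) / n) := ⟨_, rfl⟩
  obtain ⟨lamBar, hlamBar⟩ : ∃ l, l = PenalizedM.CLam c₀ CX d * Real.sqrt (Real.log (p / α) / n) :=
    ⟨_, rfl⟩
  have hepos : 0 < e := by rw [he]; positivity
  have hlamBar0 : 0 < lamBar := by rw [hlamBar]; positivity
  have hesq : e ^ 2 * n = PenalizedM.CEps c₀ CL CX ^ 2 *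
      (PenalizedM.sparsity θ₀ * Real.log (p * n)) := by
    rw [he, mul_pow, Real.sq_sqrt (by positivity)]; field_simp
  have hsplit : Real.sqrt (PenalizedM.sparsity θ₀ * Real.log (p / α) / n) =
      Real.sqrt (PenalizedM.sparsity θ₀) * Real.sqrt (Real.log (p / α) / n) := by
    rw [mul_div_assoc, Real.sqrt_mul (by positivity)]
  have hu_eq : PenalizedM.uZero n p (PenalizedM.sparsity θ₀) c₀ cM CL CX d α =
      2 / cM * (e + (1 + PenalizedM.cBar c₀) *
        (lamBar * Real.sqrt (PenalizedM.sparsity θ₀))) := by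
    rw [PenalizedM.uZero, hsplit, he, hlamBar]; ring
  have hupos : 0 < PenalizedM.uZero n p (PenalizedM.sparsity θ₀) c₀ cM CL CX d α := by
    rw [hu_eq]; positivity
  have hradius : e + lamBar * Real.sqrt (PenalizedM.sparsity θ₀) <
      cM * PenalizedM.uZero n p (PenalizedM.sparsity θ₀) c₀ cM CL CX d α := by
    have h1 : cM * PenalizedM.uZero n p (PenalizedM.sparsity θ₀) c₀ cM CL CX d α =
        2 * (e + (1 + PenalizedM.cBar c₀) *
          (lamBar * Real.sqrt (PenalizedM.sparsity θ₀))) := by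
      rw [hu_eq]; field_simp
    have h2 : 0 < lamBar * Real.sqrt (PenalizedM.sparsity θ₀) := by positivity
    nlinarith
  have hWvec : Measurable fun ω i => W i ω := measurable_pi_lambda _ hWmeas
  have hlaw : μ.map (fun ω i => W i ω) = Measure.pi fun _ : Fin n => P := by
    rw [(iIndepFun_iff_map_fun_eq_pi_map fun i => (hWmeas i).aemeasurable).1 hWindep]
    simp only [hWlaw]
  have hcoord : ∀ i j, Measurable fun w : Fin n → PenalizedM.Vec p × 𝒴 => (w i).1 j := by
    intro i j; fun_prop
  have hcov₁ := PenalizedM.measure_compl_le_of_map hWvec hlaw hζ.le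
    (G := {w | ∀ i j, |(w i).1 j| ≤ B}) (by
      simp only [Set.ofPred_forall]
      exact .iInter fun i => .iInter fun j => measurableSet_le (hcoord i j).abs measurable_const)
    hcov.1
  have hcov₂ := PenalizedM.measure_compl_le_of_map hWvec hlaw hζ.le
    (G := {w | ∀ j, ∑ i, ((w i).1 j) ^ 4 ≤ (n : ℝ) * CX ^ 4}) (by
      simp only [Set.ofPred_forall]
      exact .iInter fun j => measurableSet_le
        (Finset.measurable_sum _ fun i _ => (hcoord i j).pow_const 4) measurable_const)
    hcov.2
  rw [div_le_iff₀ (by positivity), mul_comm] at hside₁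
  rw [mul_right_comm] at hside₂
  have hfail := PenalizedM.measure_not_estimate_le hn hp hm hs hc₀ hα hζ hB hCX hcL hCL hd hΘconv
    (interior_subset hΘint) hconv hdiff hmargin hcov₁ hcov₂ hloss hmean hres hnondeg hupos hepos
    hesq (by linarith) hlamBar hradius hside₂
  obtain ⟨A, hA, hprob, hgood⟩ := PenalizedM.exists_measurableSet_of_map hWvec hlaw
    (by positivity) hfail
  refine ⟨A, hA, by linarith, fun ω hω θ hθ => ?_⟩
  obtain ⟨hcone, hnorm⟩ := hgood ω hω θ hθ
  refine ⟨hnorm, ?_⟩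
  have hl1 := PenalizedM.l1Norm_le_of_mem_restrictedSet hc.le hcone
  have hsq : ∀ a : ℝ, Real.sqrt ((PenalizedM.sparsity θ₀ : ℝ) ^ 2 * a / n) =
      Real.sqrt (PenalizedM.sparsity θ₀) * Real.sqrt (PenalizedM.sparsity θ₀ * a / n) := by
    intro a
    rw [← Real.sqrt_mul (by linarith)]
    congr 1; ring
  rw [hsq, hsq, hsplit]
  refine hl1.trans ((mul_le_mul_of_nonneg_left hnorm (by positivity)).trans (le_of_eq ?_))
  rw [hu_eq, he, hlamBar]
  ring
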